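/- Let $G$ be a connected real semisimple Lie group with finite center, with Lie algebra $\mathfrak g$ and Killing form $B$. Let $\lambda\in\mathfrak g^*$, let $X_\lambda\in\mathfrak g$ be determined by $\lambda=B(X_\lambda,\cdot)$, and assume that $\lambda$ is real hyperbolic, i.e. that $\operatorname{ad}X_\lambda$ is diagonalizable with real eigenvalues. Let $\mathfrak n(\lambda)$ (respectively $\mathfrak P(\lambda)$) be the sum of the eigenspaces of $\operatorname{ad}X_\lambda$ for the positive (respectively nonnegative) eigenvalues. Let $Z(\lambda)$ be the stabilizer of $\lambda$ for the coadjoint action, $P(\lambda)$ the parabolic subgroup of $G$ with Lie algebra $\mathfrak P(\lambda)$ (the normalizer of $\mathfrak P(\lambda)$ in $G$), and $N(\lambda)=\exp\mathfrak n(\lambda)$, with identity element $e_N$. Let $\pi:G/Z(\lambda)\to G/P(\lambda)$ be the projection, $\bar e=eZ(\lambda)$, and let $\Omega$ be the Kostant--Kirillov form on $G/Z(\lambda)$, i.e. the $G$-invariant two-form such that $\Omega_{\bar e}$ maps the pair of tangent vectors represented by $X,Y\in\mathfrak g$ to $\lambda([X,Y])$. Then $N(\lambda)$ is an embedded submanifold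 of $G$. For each $V\in\mathfrak n(\lambda)$ there is a unique vector field $H_V$ on $N(\lambda)$ such that, with $T_nN(\lambda)$ viewed as a subspace of $T_{n\bar e}(G/Z(\lambda))$ through the derivative of $n\mapsto n\bar e$, $$\Omega_{n\bar e}(Z,H_V(n))=\eta_V(d\pi(n\bar e)Z)\qquad\text{for all } n\in N(\lambda),\ Z\in T_{n\bar e}(G/Z(\lambda)),$$ where $\eta_V$ is the linear functional on $T_{eP(\lambda)}(G/P(\lambda))=\mathfrak g/\mathfrak P(\lambda)$ induced by $-B(V,\cdot)$. This vector field is smooth. Moreover: 1. For all $V_1,V_2\in\mathfrak n(\lambda)$ the vector fields $H_{V_1}$ and $H_{V_2}$ commute: $[H_{V_1},H_{V_2}]=0$. 2. For each $V\in\mathfrak n(\lambda)$ the flow of $H_V$ is defined as a smooth map $\mathbb R\times N(\lambda)\to N(\lambda)$, $(t,n)\mapsto\exp(tH_V)n$. 3. The map $V\mapsto\exp(H_V)e_N$, the value at time $1$ of the flow of $H_V$ starting at $e_N$, is a diffeomorphism from $\mathfrak n(\lambda)$ onto $N(\lambda)$. -/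

import Mathlib

open scoped Manifold ContDiff

noncomputable section

namespace HyperbolicOrbit

variable {E : Type*} [NormedAddCommGroup E] [NormedSpace ℝ E] [FiniteDimensional ℝ E]
  {G : Type*} [TopologicalSpace G] [ChartedSpace E G] [Group G] [LieGroup 𝓘(ℝ, E) ∞ G]

/-- A smooth Lie group has the order of smoothness at which Mathlib puts a Lie bracket on its
tangent space at the identity. -/
instance instLieGroupMinSmoothness : LieGroup 𝓘(ℝ, E) (minSmoothness ℝ 3) G :=
  LieGroup.of_le (n := ∞) (by
    simp only [minSmoothness_of_isRCLikeNormedField]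
    exact ENat.LEInfty.out)

variable (E G) in
/-- The Lie algebra of `G`, the tangent space at the identity, is by definition a copy of the model
space `E`, but without a norm; this is the identity map from one to the other. -/
def modelEquiv : GroupLieAlgebra 𝓘(ℝ, E) G ≃ₗ[ℝ] E :=
  LinearEquiv.refl ℝ E

instance instFiniteDimensionalLieAlgebra :
    FiniteDimensional ℝ (GroupLieAlgebra 𝓘(ℝ, E) G) :=
  inferInstanceAs (FiniteDimensional ℝ E)

/-- The derivative at `g` of left translation by `g⁻¹`, from `T_g G` to the Lie algebra. -/
def leftTriv (g : G) : TangentSpace 𝓘(ℝ, E) g →L[ℝ] GroupLieAlgebra 𝓘(ℝ, E) G :=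
  mfderiv 𝓘(ℝ, E) 𝓘(ℝ, E) (fun x : G => g⁻¹ * x) g

/-- The derivative at `g` of right translation by `g⁻¹`, from `T_g G` to the Lie algebra. -/
def rightTriv (g : G) : TangentSpace 𝓘(ℝ, E) g →L[ℝ] GroupLieAlgebra 𝓘(ℝ, E) G :=
  mfderiv 𝓘(ℝ, E) 𝓘(ℝ, E) (fun x : G => x * g⁻¹) g

/-- `g = exp U`: the integral curve through the identity of the left invariant vector field
determined by `U` reaches `g` at time one. -/
def IsExp (U : GroupLieAlgebra 𝓘(ℝ, E) G) (g : G) : Prop :=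
  ∃ γ : ℝ → G, γ 0 = 1 ∧ IsMIntegralCurve (I := 𝓘(ℝ, E)) γ (mulInvariantVectorField U) ∧ γ 1 = g

/-- The element `X_l` of the Lie algebra with `l = B(X_l, ·)`, where `B` is the Killing form. -/
def dualVector [LieAlgebra.IsSemisimple ℝ (GroupLieAlgebra 𝓘(ℝ, E) G)]
    (l : Module.Dual ℝ (GroupLieAlgebra 𝓘(ℝ, E) G)) : GroupLieAlgebra 𝓘(ℝ, E) G :=
  ((killingForm ℝ (GroupLieAlgebra 𝓘(ℝ, E) G)).toDual
    (LieAlgebra.IsKilling.killingForm_nondegenerate _ _)).symm l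

section Orbit

variable [LieAlgebra.IsSemisimple ℝ (GroupLieAlgebra 𝓘(ℝ, E) G)]

/-- `l` is real hyperbolic: `ad X_l` is diagonalizable over the reals. -/
def IsRealHyperbolic (l : Module.Dual ℝ (GroupLieAlgebra 𝓘(ℝ, E) G)) : Prop :=
  ⨆ μ : ℝ, Module.End.eigenspace
    (LieAlgebra.ad ℝ (GroupLieAlgebra 𝓘(ℝ, E) G) (dualVector l)) μ = ⊤

/-- `𝔷(l)`, the Lie algebra of the stabilizer `Z(l)` of `l` for the coadjoint action. -/
def stabAlg (l : Module.Dual ℝ (GroupLieAlgebra 𝓘(ℝ, E) G)) :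
    Submodule ℝ (GroupLieAlgebra 𝓘(ℝ, E) G) where
  carrier := {X | ∀ Y, l ⁅X, Y⁆ = 0}
  add_mem' := fun {X X'} h h' Y => by rw [add_lie, map_add, h Y, h' Y, add_zero]
  zero_mem' := fun Y => by rw [zero_lie, map_zero]
  smul_mem' := fun c X h Y => by rw [smul_lie, map_smul, h Y, smul_zero]

/-- `𝔓(l)`, the Lie algebra of the parabolic subgroup `P(l)`: the sum of the eigenspaces of
`ad X_l` for the nonnegative eigenvalues. -/
def parabolicAlg (l : Module.Dual ℝ (GroupLieAlgebra 𝓘(ℝ, E) G)) :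
    Submodule ℝ (GroupLieAlgebra 𝓘(ℝ, E) G) :=
  ⨆ μ : {μ : ℝ // 0 ≤ μ}, Module.End.eigenspace
    (LieAlgebra.ad ℝ (GroupLieAlgebra 𝓘(ℝ, E) G) (dualVector l)) μ.1

/-- `𝔫(l)`, the nilpotent radical of `𝔓(l)`: the sum of the eigenspaces of `ad X_l` for the
positive eigenvalues. -/
def nilAlg (l : Module.Dual ℝ (GroupLieAlgebra 𝓘(ℝ, E) G)) :
    Submodule ℝ (GroupLieAlgebra 𝓘(ℝ, E) G) :=
  ⨆ μ : {μ : ℝ // 0 < μ}, Module.End.eigenspace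
    (LieAlgebra.ad ℝ (GroupLieAlgebra 𝓘(ℝ, E) G) (dualVector l)) μ.1

/-- `𝔫(l)` as a subspace of the normed space `E`. This copy serves as a manifold. -/
def nilSpace (l : Module.Dual ℝ (GroupLieAlgebra 𝓘(ℝ, E) G)) : Submodule ℝ E :=
  (nilAlg l).map (modelEquiv E G).toLinearMap

/-- An element of `𝔫(l)` as an element of the Lie algebra. -/
def toLieAlg {l : Module.Dual ℝ (GroupLieAlgebra 𝓘(ℝ, E) G)} (V : nilSpace l) :
    GroupLieAlgebra 𝓘(ℝ, E) G :=
  (modelEquiv E G).symm V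

theorem toLieAlg_mem {l : Module.Dual ℝ (GroupLieAlgebra 𝓘(ℝ, E) G)} (V : nilSpace l) :
    toLieAlg V ∈ nilAlg l :=
  (Submodule.mem_map_equiv (nilAlg l) (e := modelEquiv E G)).mp V.2

/-- `N(l) = exp 𝔫(l)`. -/
def nilGroup (l : Module.Dual ℝ (GroupLieAlgebra 𝓘(ℝ, E) G)) : Set G :=
  {g | ∃ U ∈ nilAlg l, IsExp U g}

theorem one_mem_nilGroup (l : Module.Dual ℝ (GroupLieAlgebra 𝓘(ℝ, E) G)) :
    (1 : G) ∈ nilGroup l := by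
  refine ⟨0, zero_mem _, fun _ => 1, rfl, fun t => ?_, rfl⟩
  have h0 : mulInvariantVectorField (0 : GroupLieAlgebra 𝓘(ℝ, E) G) (1 : G) = 0 := by
    unfold mulInvariantVectorField
    exact map_zero _
  simp only [h0, ContinuousLinearMap.smulRight_zero]
  exact hasMFDerivAt_const _ _

/-- The identity element of `N(l)`. -/
def nilGroupOne (l : Module.Dual ℝ (GroupLieAlgebra 𝓘(ℝ, E) G)) : nilGroup l :=
  ⟨1, one_mem_nilGroup l⟩

/-- The tangent space of `G/Z(l)` at `gZ(l)`: `T_g G` modulo the left translate by `g` of `𝔷(l)`,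
which is the kernel of the derivative at `g` of the projection `G → G/Z(l)`. -/
abbrev OrbitTangent (l : Module.Dual ℝ (GroupLieAlgebra 𝓘(ℝ, E) G)) (g : G) : Type _ :=
  TangentSpace 𝓘(ℝ, E) g ⧸ (stabAlg l).comap (leftTriv g).toLinearMap

/-- The bilinear form `(X, Y) ↦ l [X, Y]` on the Lie algebra. -/
def bracketForm (l : Module.Dual ℝ (GroupLieAlgebra 𝓘(ℝ, E) G)) :
    LinearMap.BilinForm ℝ (GroupLieAlgebra 𝓘(ℝ, E) G) :=
  LinearMap.mk₂ ℝ (fun X Y => l ⁅X, Y⁆)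
    (fun X X' Y => by rw [add_lie, map_add])
    (fun c X Y => by rw [smul_lie, map_smul])
    (fun X Y Y' => by rw [lie_add, map_add])
    (fun c X Y => by rw [lie_smul, map_smul])

/-- The Kostant-Kirillov form on `G/Z(l)` at `gZ(l)`: the `G`-invariant two-form that sends the
pair of tangent vectors at the base point represented by `X`, `Y` to `l [X, Y]`. -/
def kirillovForm (l : Module.Dual ℝ (GroupLieAlgebra 𝓘(ℝ, E) G)) (g : G) :
    LinearMap.BilinForm ℝ (OrbitTangent l g) :=
  LinearMap.liftQ₂ _ _
    ((bracketForm l).compl₁₂ (leftTriv g).toLinearMap (leftTriv g).toLinearMap)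
    (fun Z hZ => by
      ext W
      exact hZ (leftTriv g W))
    (fun Z hZ => by
      ext W
      have h := hZ (leftTriv g W)
      change l ⁅leftTriv g W, leftTriv g Z⁆ = 0
      rw [← lie_skew, map_neg, neg_eq_zero]
      exact h)

theorem killingForm_eq_zero_of_mem (l : Module.Dual ℝ (GroupLieAlgebra 𝓘(ℝ, E) G))
    {V X : GroupLieAlgebra 𝓘(ℝ, E) G} (hV : V ∈ nilAlg l) (hX : X ∈ parabolicAlg l) :
    killingForm ℝ (GroupLieAlgebra 𝓘(ℝ, E) G) V X = 0 := by
  have h1 : nilAlg l ≤ (parabolicAlg l).orthogonalBilin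
      (killingForm ℝ (GroupLieAlgebra 𝓘(ℝ, E) G)).flip := by
    refine iSup_le fun μ V hV => ?_
    rw [Submodule.mem_orthogonalBilin_iff]
    intro X hX
    change killingForm ℝ _ V X = 0
    have h2 : parabolicAlg l ≤ LinearMap.ker (killingForm ℝ (GroupLieAlgebra 𝓘(ℝ, E) G) V) := by
      refine iSup_le fun ν Y hY => ?_
      rw [LinearMap.mem_ker]
      rw [Module.End.mem_eigenspace_iff, LieAlgebra.ad_apply] at hV hY
      have h := LieModule.traceForm_apply_lie_apply ℝ (GroupLieAlgebra 𝓘(ℝ, E) G)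
        (GroupLieAlgebra 𝓘(ℝ, E) G) V (dualVector l) Y
      rw [hY, ← lie_skew, hV] at h
      simp only [map_neg, map_smul, LinearMap.neg_apply, LinearMap.smul_apply, smul_eq_mul] at h
      have h3 : (μ.1 + ν.1) * killingForm ℝ (GroupLieAlgebra 𝓘(ℝ, E) G) V Y = 0 := by
        simp only [killingForm]
        linarith
      exact (mul_eq_zero.mp h3).resolve_left (by have := μ.2; have := ν.2; linarith)
    exact h2 hX
  exact (Submodule.mem_orthogonalBilin_iff.mp (h1 hV)) X hX

/-- The functional `η_V = -B(V, ·)` on `𝔤/𝔓(l)`, the tangent space of `G/P(l)` at its base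
point. -/
def eta (l : Module.Dual ℝ (GroupLieAlgebra 𝓘(ℝ, E) G)) (V : nilSpace l) :
    Module.Dual ℝ (GroupLieAlgebra 𝓘(ℝ, E) G ⧸ parabolicAlg l) :=
  (parabolicAlg l).liftQ (-(killingForm ℝ (GroupLieAlgebra 𝓘(ℝ, E) G) (toLieAlg V)))
    (fun X hX => by
      rw [LinearMap.mem_ker, LinearMap.neg_apply, killingForm_eq_zero_of_mem l (toLieAlg_mem V) hX, neg_zero])

/-- The derivative `T_n G → T_{nP(l)}(G/P(l)) = 𝔤/𝔓(l)` of the projection `G → G/P(l)` at a point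
`n` of `P(l)`. The projection does not change if it is composed with the right translation by the
element `n⁻¹` of `P(l)`, so that its derivative at `n` is that of this translation, followed by the
derivative `𝔤 → 𝔤/𝔓(l)` of the projection at the identity. -/
def projDeriv (l : Module.Dual ℝ (GroupLieAlgebra 𝓘(ℝ, E) G)) (n : G) :
    TangentSpace 𝓘(ℝ, E) n →ₗ[ℝ] (GroupLieAlgebra 𝓘(ℝ, E) G ⧸ parabolicAlg l) :=
  (parabolicAlg l).mkQ ∘ₗ (rightTriv n).toLinearMap

/-- The vector `h` of `T_{nZ(l)}(G/Z(l))`, where `n` lies in `N(l)`, is the value there of the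
vertical field `H_V`: one has `Ω(Z, h) = η_V(dπ Z)` for all tangent vectors `Z` at the point
`nZ(l)`, where `π : G/Z(l) → G/P(l)` is the projection. Here `Z` runs over the images of the
vectors `Y` of `T_n G`, and then `dπ Z` is the image of `Y` under the derivative of `G → G/P(l)`. -/
def IsVerticalVector (l : Module.Dual ℝ (GroupLieAlgebra 𝓘(ℝ, E) G)) (V : nilSpace l) (n : G)
    (h : OrbitTangent l n) : Prop :=
  ∀ Y : TangentSpace 𝓘(ℝ, E) n,
    kirillovForm l n (Submodule.Quotient.mk Y) h = eta l V (projDeriv l n Y)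

/-- The derivative `T_n N(l) → T_{nZ(l)}(G/Z(l))` of the map `n ↦ nZ(l)`, for a manifold structure
on `N(l)` modelled on `𝔫(l)`. -/
def fiberDeriv (l : Module.Dual ℝ (GroupLieAlgebra 𝓘(ℝ, E) G))
    [ChartedSpace (nilSpace l) (nilGroup l)] (n : nilGroup l) : TangentSpace 𝓘(ℝ, nilSpace l) n →ₗ[ℝ] OrbitTangent l (n : G) :=
  Submodule.mkQ _ ∘ₗ
    (mfderiv 𝓘(ℝ, nilSpace l) 𝓘(ℝ, E) (Subtype.val : nilGroup l → G) n).toLinearMap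

/-- The given manifold structure makes `N(l)`, with the topology induced by `G`, an embedded
submanifold of `G`. There is at most one such structure. -/
structure IsEmbeddedSubmanifold (l : Module.Dual ℝ (GroupLieAlgebra 𝓘(ℝ, E) G))
    [ChartedSpace (nilSpace l) (nilGroup l)] [IsManifold 𝓘(ℝ, nilSpace l) ∞ (nilGroup l)] :
    Prop where
  contMDiff_val : ContMDiff 𝓘(ℝ, nilSpace l) 𝓘(ℝ, E) ∞ (Subtype.val : nilGroup l → G)
  injective_mfderiv_val : ∀ n : nilGroup l, Function.Injective
    (mfderiv 𝓘(ℝ, nilSpace l) 𝓘(ℝ, E) (Subtype.val : nilGroup l → G) n)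

end Orbit

end HyperbolicOrbit
end

/-!
Write `X = X_l`, `𝔫 = 𝔫(l)`, `N = N(l)`, and consider the map `F(g) = X - Ad(g) X` from `G` to its
Lie algebra. The theorem holds because `F` restricts to a global chart `N → 𝔫` in which every field
`H_V` is the constant field `V`.

The equation for `H_V`. The derivative of `F` maps `Y ∈ T_n G` to `Ad(n) [X, n⁻¹Y]`
(`mfderiv_orbitMap`). As `l = B(X, ·)` and `B` is invariant under the bracket and under `Ad(n)`, the
number `Ω(Y, W) = l [n⁻¹Y, n⁻¹W]` is `-B(Ad(n) [X, n⁻¹W], Yn⁻¹)`, whereas `η_V(dπ Y)` is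
`-B(V, Yn⁻¹)`. Since `B` is nondegenerate, `W` satisfies the equation for `V` exactly when
`dF_n(W) = V` (`isVerticalVector_iff`).

The chart. One has `F(exp U) = X - exp(ad U) X = [X, U] + R(U)`. Here `ad X` is invertible on `𝔫`,
say with inverse `K`, and `R` collects the terms with at least two brackets. Filter `𝔫` by the sums
of the eigenspaces of `ad X` for the eigenvalues that are at least `s`, and let `δ` be a positive
lower bound for the positive eigenvalues: if `U - U'` has level `s`, then `R(U) - R(U')` has level
`s + δ` (`orbitRest_sub_mem`). The filtration is finite, so the iterates of `U ↦ K(V - R(U))`, which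
depend smoothly on `V`, become stationary after a bounded number of steps, at the only solution in
`𝔫` of `X - exp(ad U) X = V` (`exists_smooth_inverse_orbit`). The resulting smooth map `S` of `E`
maps `𝔫` to itself, and `exp ∘ S` is the inverse of `F : N → 𝔫` (`exists_homeomorph_nilSpace`).
Transport of structure makes `N` a manifold with `F` as its only chart. The inclusion into `G` is
`exp ∘ S ∘ F`, hence smooth, and it is an immersion because its composite with the smooth map
`F` on `G` is the chart.

In this chart everything is explicit: the fields are constant and commute, the flow is
`(t, n) ↦ F⁻¹(F(n) + tV)`, and its value at time one at the identity, where `F` vanishes, is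
`F⁻¹(V)`.

Lie theory. Three facts are proved here from the bracket of left invariant vector fields: the
derivative of `Ad` at the identity is `ad` (`hasMFDerivAt_Ad_one` with `adL_apply`), `Ad(exp U)` is
`exp(ad U)` (`Ad_oneParam`), and the exponential map is smooth (`contMDiff_expMap`). For the last
one it is used that the Lie algebra has no centre, so that `Ad` is an immersion: near `0` the
exponential map is `U ↦ exp(ad U)` read through a local inverse of `Ad`, and the identity
`exp U = (exp(U/k))^k` gives smoothness everywhere.
-/

noncomputable section

namespace HyperbolicOrbit

set_option linter.unusedSectionVars false

/-! ### Second derivatives of a multiplication in a chart -/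

section Calculus

variable {E : Type*} [NormedAddCommGroup E] [NormedSpace ℝ E]

open Filter Topology VectorField

theorem eventually_fderiv_snd {F : E × E → E} {e : E} (hF : ContDiffAt ℝ 2 F (e, e)) :
    ∀ᶠ y in 𝓝 e, fderiv ℝ (fun x => F (y, x)) e =
      (fderiv ℝ F (y, e)).comp (ContinuousLinearMap.inr ℝ E E) := by
  have h1 : ∀ᶠ p in 𝓝 (e, e), DifferentiableAt ℝ F p :=
    (hF.eventually (by simp)).mono fun p hp => hp.differentiableAt (by simp)
  have h2 : Tendsto (fun y : E => (y, e)) (𝓝 e) (𝓝 (e, e)) :=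
    (Continuous.prodMk continuous_id continuous_const).tendsto e
  filter_upwards [h2.eventually h1] with y hy
  exact (hy.hasFDerivAt.comp e (hasFDerivAt_prodMk_right y e)).fderiv

theorem eventually_fderiv_fst {F : E × E → E} {e : E} (hF : ContDiffAt ℝ 2 F (e, e)) :
    ∀ᶠ y in 𝓝 e, fderiv ℝ (fun x => F (x, y)) e =
      (fderiv ℝ F (e, y)).comp (ContinuousLinearMap.inl ℝ E E) := by
  have h1 : ∀ᶠ p in 𝓝 (e, e), DifferentiableAt ℝ F p :=
    (hF.eventually (by simp)).mono fun p hp => hp.differentiableAt (by simp)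
  have h2 : Tendsto (fun y : E => (e, y)) (𝓝 e) (𝓝 (e, e)) :=
    (Continuous.prodMk continuous_const continuous_id).tendsto e
  filter_upwards [h2.eventually h1] with y hy
  exact (hy.hasFDerivAt.comp e (hasFDerivAt_prodMk_left e y)).fderiv

theorem hasFDerivAt_fderiv_snd {F : E × E → E} {e : E} (hF : ContDiffAt ℝ 2 F (e, e)) :
    HasFDerivAt (fun y => fderiv ℝ (fun x => F (y, x)) e)
      (((ContinuousLinearMap.compL ℝ E (E × E) E).flip (ContinuousLinearMap.inr ℝ E E)).comp
        ((fderiv ℝ (fderiv ℝ F) (e, e)).comp (ContinuousLinearMap.inl ℝ E E))) e := by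
  have h1 : HasFDerivAt (fderiv ℝ F) (fderiv ℝ (fderiv ℝ F) (e, e)) (e, e) :=
    ((hF.fderiv_right (m := 1) (by norm_num)).differentiableAt (by simp)).hasFDerivAt
  have h2 := HasFDerivAt.comp (f := fun y : E => (y, e)) e h1 (hasFDerivAt_prodMk_left e e)
  have h3 := ((ContinuousLinearMap.compL ℝ E (E × E) E).flip
    (ContinuousLinearMap.inr ℝ E E)).hasFDerivAt.comp e h2
  exact h3.congr_of_eventuallyEq (eventually_fderiv_snd hF)

theorem hasFDerivAt_fderiv_fst {F : E × E → E} {e : E} (hF : ContDiffAt ℝ 2 F (e, e)) :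
    HasFDerivAt (fun y => fderiv ℝ (fun x => F (x, y)) e)
      (((ContinuousLinearMap.compL ℝ E (E × E) E).flip (ContinuousLinearMap.inl ℝ E E)).comp
        ((fderiv ℝ (fderiv ℝ F) (e, e)).comp (ContinuousLinearMap.inr ℝ E E))) e := by
  have h1 : HasFDerivAt (fderiv ℝ F) (fderiv ℝ (fderiv ℝ F) (e, e)) (e, e) :=
    ((hF.fderiv_right (m := 1) (by norm_num)).differentiableAt (by simp)).hasFDerivAt
  have h2 := HasFDerivAt.comp (f := fun y : E => (e, y)) e h1 (hasFDerivAt_prodMk_right e e)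
  have h3 := ((ContinuousLinearMap.compL ℝ E (E × E) E).flip
    (ContinuousLinearMap.inl ℝ E E)).hasFDerivAt.comp e h2
  exact h3.congr_of_eventuallyEq (eventually_fderiv_fst hF)

/-- Let `M` be a multiplication near `(e, e)` with neutral element `e`, and `C (y, x) = y x y⁻¹` the
conjugation, which is characterized by `M (C (y, x), y) = M (y, x)`. The derivative at `e` of
`y ↦ D (C (y, ·)) (e)` is the bracket of the left invariant fields `y ↦ D (M (y, ·)) (e)`. The
associativity of `M` plays no role. -/
theorem fderiv_conjugation_eq_lieBracket {M C : E × E → E} {e : E}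
    (hM : ContDiffAt ℝ 2 M (e, e)) (hC : ContDiffAt ℝ 2 C (e, e))
    (hMe : ∀ᶠ y in 𝓝 e, M (y, e) = y) (heM : ∀ᶠ x in 𝓝 e, M (e, x) = x)
    (hCe : ∀ᶠ y in 𝓝 e, C (y, e) = e) (heC : ∀ᶠ x in 𝓝 e, C (e, x) = x)
    (h : ∀ᶠ p in 𝓝 (e, e), M (C p, p.1) = M p) (W Z : E) :
    fderiv ℝ (fun y => fderiv ℝ (fun x => C (y, x)) e) e W Z =
      lieBracket ℝ (fun y => fderiv ℝ (fun x => M (y, x)) e W)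
        (fun y => fderiv ℝ (fun x => M (y, x)) e Z) e := by
  have hL := hasFDerivAt_fderiv_snd hM
  have hR := hasFDerivAt_fderiv_fst hM
  have hA := hasFDerivAt_fderiv_snd hC
  have hL0 : fderiv ℝ (fun x => M (e, x)) e = ContinuousLinearMap.id ℝ E := by
    rw [Filter.EventuallyEq.fderiv_eq (f₁ := fun x => M (e, x)) (f := id) heM, fderiv_id]
  have hR0 : fderiv ℝ (fun x => M (x, e)) e = ContinuousLinearMap.id ℝ E := by
    rw [Filter.EventuallyEq.fderiv_eq (f₁ := fun x => M (x, e)) (f := id) hMe, fderiv_id]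
  have hA0 : fderiv ℝ (fun x => C (e, x)) e = ContinuousLinearMap.id ℝ E := by
    rw [Filter.EventuallyEq.fderiv_eq (f₁ := fun x => C (e, x)) (f := id) heC, fderiv_id]
  -- The identity `M (C (y, x), y) = M (y, x)` differentiated in `x` at `e`.
  have key : ∀ᶠ y in 𝓝 e, (fderiv ℝ (fun x => M (x, y)) e).comp (fderiv ℝ (fun x => C (y, x)) e) =
      fderiv ℝ (fun x => M (y, x)) e := by
    have h1 : ∀ᶠ p in 𝓝 (e, e), DifferentiableAt ℝ M p :=
      (hM.eventually (by simp)).mono fun p hp => hp.differentiableAt (by simp)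
    have h1' : ∀ᶠ p in 𝓝 (e, e), DifferentiableAt ℝ C p :=
      (hC.eventually (by simp)).mono fun p hp => hp.differentiableAt (by simp)
    have h2 : Tendsto (fun y : E => (y, e)) (𝓝 e) (𝓝 (e, e)) :=
      (Continuous.prodMk continuous_id continuous_const).tendsto e
    have h2' : Tendsto (fun y : E => (e, y)) (𝓝 e) (𝓝 (e, e)) :=
      (Continuous.prodMk continuous_const continuous_id).tendsto e
    filter_upwards [h2'.eventually h1, h2.eventually h1', hCe, h2.eventually h.eventually_nhds]
      with y hy1 hy2 hy3 hy4
    have h5 : (fun x => M (y, x)) =ᶠ[𝓝 e] fun x => M (C (y, x), y) := by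
      have h2'' : Tendsto (fun x : E => (y, x)) (𝓝 e) (𝓝 (y, e)) :=
        (Continuous.prodMk continuous_const continuous_id).tendsto e
      filter_upwards [h2''.eventually hy4] with x hx
      exact hx.symm
    rw [h5.fderiv_eq]
    have h6 : DifferentiableAt ℝ (fun x => C (y, x)) e :=
      (hy2.hasFDerivAt.comp e (hasFDerivAt_prodMk_right y e)).differentiableAt
    have h7 : DifferentiableAt ℝ (fun x => M (x, y)) (C (y, e)) := by
      rw [hy3]
      exact (hy1.hasFDerivAt.comp e (hasFDerivAt_prodMk_left e y)).differentiableAt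
    have h8 := (h7.hasFDerivAt.comp e h6.hasFDerivAt).fderiv
    rw [hy3] at h8
    exact h8.symm
  have hRA := hR.clm_comp hA
  have heq := (hL.congr_of_eventuallyEq key).unique hRA
  have hsymm := hM.isSymmSndFDerivAt (by simp)
  have heq' := congrArg (fun T => T W Z) heq
  rw [hR0, hA0] at heq'
  have hLW : HasFDerivAt (fun y => fderiv ℝ (fun x => M (y, x)) e W) _ e :=
    hL.clm_apply (hasFDerivAt_const W e)
  have hLZ : HasFDerivAt (fun y => fderiv ℝ (fun x => M (y, x)) e Z) _ e :=
    hL.clm_apply (hasFDerivAt_const Z e)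
  rw [lieBracket, hLW.fderiv, hLZ.fderiv, hA.fderiv, hL0]
  simp at heq' ⊢
  rw [heq', hsymm]
  abel

end Calculus

/-! ### The adjoint representation and its derivative at the identity -/

section Adjoint

variable {E : Type*} [NormedAddCommGroup E] [NormedSpace ℝ E] [FiniteDimensional ℝ E]
  {G : Type*} [TopologicalSpace G] [ChartedSpace E G] [Group G] [LieGroup 𝓘(ℝ, E) ∞ G]

open Filter Topology VectorField Set

/-- The adjoint representation: `Ad g` is the derivative at `1` of `x ↦ g x g⁻¹`. It is taken as an
endomorphism of the model space `E`, of which the Lie algebra is a copy without a norm; the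
derivative really has values in the tangent space at `g * 1 * g⁻¹`, another copy of `E`. -/
def Ad (g : G) : E →L[ℝ] E :=
  mfderiv 𝓘(ℝ, E) 𝓘(ℝ, E) (fun x : G => g * x * g⁻¹) 1

theorem contMDiff_conj (g : G) :
    ContMDiff 𝓘(ℝ, E) 𝓘(ℝ, E) ∞ (fun x : G => g * x * g⁻¹) :=
  (contMDiff_const.mul contMDiff_id).mul contMDiff_const

theorem mdifferentiable_conj (g : G) :
    MDifferentiable 𝓘(ℝ, E) 𝓘(ℝ, E) (fun x : G => g * x * g⁻¹) :=
  (contMDiff_conj g).mdifferentiable (by simp)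

/-- The base point is a variable here so that it may be an expression that is only provably equal
to `1`. -/
theorem Ad_eq_of_eq_one (g x : G) (hx : x = 1) :
    mfderiv 𝓘(ℝ, E) 𝓘(ℝ, E) (fun x : G => g * x * g⁻¹) x = Ad (E := E) g := by
  subst hx
  rfl

theorem Ad_mul (g h : G) : (Ad (g * h) : E →L[ℝ] E) = (Ad g).comp (Ad h) := by
  have h1 : (fun x : G => g * h * x * (g * h)⁻¹) =
      (fun x : G => g * x * g⁻¹) ∘ (fun x : G => h * x * h⁻¹) := by
    ext x
    simp only [Function.comp_apply]
    group
  have h2 := mfderiv_comp (1 : G) (mdifferentiable_conj (E := E) g (h * 1 * h⁻¹))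
    (mdifferentiable_conj h 1)
  rw [← h1] at h2
  have h3 := Ad_eq_of_eq_one (E := E) g (h * 1 * h⁻¹) (by group)
  rw [h3] at h2
  exact h2

theorem Ad_one : (Ad (1 : G) : E →L[ℝ] E) = ContinuousLinearMap.id ℝ E := by
  have h1 : (fun x : G => 1 * x * 1⁻¹) = id := by
    ext x
    simp
  unfold Ad
  rw [h1]
  exact mfderiv_id

theorem Ad_inv_comp (g : G) : (Ad g⁻¹ : E →L[ℝ] E).comp (Ad g) = ContinuousLinearMap.id ℝ E := by
  rw [← Ad_mul, inv_mul_cancel, Ad_one]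

theorem Ad_comp_inv (g : G) : (Ad g : E →L[ℝ] E).comp (Ad g⁻¹) = ContinuousLinearMap.id ℝ E := by
  rw [← Ad_mul, mul_inv_cancel, Ad_one]

variable (E G) in
/-- The multiplication of `G` read in the chart at the identity. -/
def chartMul (p : E × E) : E :=
  extChartAt 𝓘(ℝ, E) (1 : G)
    ((extChartAt 𝓘(ℝ, E) (1 : G)).symm p.1 * (extChartAt 𝓘(ℝ, E) (1 : G)).symm p.2)

variable (E G) in
/-- The conjugation `(y, x) ↦ y x y⁻¹` of `G` read in the chart at the identity. -/
def chartConj (p : E × E) : E :=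
  extChartAt 𝓘(ℝ, E) (1 : G)
    ((extChartAt 𝓘(ℝ, E) (1 : G)).symm p.1 * (extChartAt 𝓘(ℝ, E) (1 : G)).symm p.2 *
      ((extChartAt 𝓘(ℝ, E) (1 : G)).symm p.1)⁻¹)

variable (E G) in
/-- The coordinates of the identity. -/
def chartOne : E := extChartAt 𝓘(ℝ, E) (1 : G) 1

theorem symm_chartOne : (extChartAt 𝓘(ℝ, E) (1 : G)).symm (chartOne E G) = 1 :=
  extChartAt_to_inv 1

theorem contMDiffAt_symm_chartOne :
    ContMDiffAt 𝓘(ℝ, E) 𝓘(ℝ, E) ∞ (extChartAt 𝓘(ℝ, E) (1 : G)).symm (chartOne E G) := by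
  exact (contMDiffOn_extChartAt_symm (n := ∞) (1 : G)).contMDiffAt (extChartAt_target_mem_nhds 1)

theorem contMDiffAt_symm_fst : ContMDiffAt 𝓘(ℝ, E × E) 𝓘(ℝ, E) ∞
    (fun p : E × E => (extChartAt 𝓘(ℝ, E) (1 : G)).symm p.1) (chartOne E G, chartOne E G) :=
  ContMDiffAt.comp (g := (extChartAt 𝓘(ℝ, E) (1 : G)).symm) _ contMDiffAt_symm_chartOne
    contDiff_fst.contMDiff.contMDiffAt

theorem contMDiffAt_symm_snd : ContMDiffAt 𝓘(ℝ, E × E) 𝓘(ℝ, E) ∞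
    (fun p : E × E => (extChartAt 𝓘(ℝ, E) (1 : G)).symm p.2) (chartOne E G, chartOne E G) :=
  ContMDiffAt.comp (g := (extChartAt 𝓘(ℝ, E) (1 : G)).symm) _ contMDiffAt_symm_chartOne
    contDiff_snd.contMDiff.contMDiffAt

theorem contDiffAt_chartMul :
    ContDiffAt ℝ ∞ (chartMul E G) (chartOne E G, chartOne E G) := by
  rw [← contMDiffAt_iff_contDiffAt]
  refine ContMDiffAt.comp (g := extChartAt 𝓘(ℝ, E) (1 : G)) (I' := 𝓘(ℝ, E)) _ ?_
    (contMDiffAt_symm_fst.mul contMDiffAt_symm_snd)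
  simp only [symm_chartOne, mul_one]
  exact contMDiffAt_extChartAt

theorem contDiffAt_chartConj :
    ContDiffAt ℝ ∞ (chartConj E G) (chartOne E G, chartOne E G) := by
  rw [← contMDiffAt_iff_contDiffAt]
  refine ContMDiffAt.comp (g := extChartAt 𝓘(ℝ, E) (1 : G)) (I' := 𝓘(ℝ, E)) _ ?_
    ((contMDiffAt_symm_fst.mul contMDiffAt_symm_snd).mul contMDiffAt_symm_fst.inv)
  simp only [symm_chartOne, mul_one, inv_one]
  exact contMDiffAt_extChartAt

/-- Near the identity, `Ad` is the partial derivative of the conjugation read in the chart. -/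
theorem Ad_eq_fderiv {g : G} (hg : g ∈ (extChartAt 𝓘(ℝ, E) (1 : G)).source) :
    Ad g = fderiv ℝ (fun x => chartConj E G (extChartAt 𝓘(ℝ, E) (1 : G) g, x)) (chartOne E G) := by
  have h1 : g * 1 * g⁻¹ = 1 := by group
  unfold Ad
  rw [(mdifferentiable_conj g 1).mfderiv]
  have h2 : (writtenInExtChartAt 𝓘(ℝ, E) 𝓘(ℝ, E) (1 : G) (fun x : G => g * x * g⁻¹)) =
      fun x => chartConj E G (extChartAt 𝓘(ℝ, E) (1 : G) g, x) := by
    ext x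
    simp only [writtenInExtChartAt, Function.comp_apply, chartConj]
    rw [(extChartAt 𝓘(ℝ, E) (1 : G)).left_inv hg, h1]
  rw [h2]
  rw [modelWithCornersSelf_coe, range_id]
  exact congrFun fderivWithin_univ _

/-- A left invariant field, read in the chart at the identity. -/
theorem mpullbackWithin_mulInvariantVectorField (V : GroupLieAlgebra 𝓘(ℝ, E) G) {y : E}
    (hy : y ∈ (extChartAt 𝓘(ℝ, E) (1 : G)).target) :
    mpullbackWithin 𝓘(ℝ, E) 𝓘(ℝ, E) (extChartAt 𝓘(ℝ, E) (1 : G)).symm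
      (mulInvariantVectorField V) (range 𝓘(ℝ, E)) y =
      fderiv ℝ (fun x => chartMul E G (y, x)) (chartOne E G) V := by
  have hinv := ContinuousLinearMap.inverse_eq
    (mfderivWithin_extChartAt_symm_comp_mfderiv_extChartAt (I := 𝓘(ℝ, E)) hy)
    (mfderiv_extChartAt_comp_mfderivWithin_extChartAt_symm (I := 𝓘(ℝ, E)) hy)
  rw [mpullbackWithin_apply, hinv]
  set g : G := (extChartAt 𝓘(ℝ, E) (1 : G)).symm y with hg
  have hgs : g ∈ (chartAt E (1 : G)).source := by
    rw [← extChartAt_source 𝓘(ℝ, E)]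
    exact (extChartAt 𝓘(ℝ, E) (1 : G)).map_target hy
  have h1 : MDifferentiableAt 𝓘(ℝ, E) 𝓘(ℝ, E) (extChartAt 𝓘(ℝ, E) (1 : G)) g :=
    mdifferentiableAt_extChartAt hgs
  have h2 : MDifferentiableAt 𝓘(ℝ, E) 𝓘(ℝ, E) (fun x : G => g * x) 1 :=
    ((contMDiff_mul_left (I := 𝓘(ℝ, E)) (n := ∞) (a := g)).mdifferentiable (by simp)) 1
  have h3 := mfderiv_comp_apply_of_eq (1 : G) h1 h2 (mul_one g) V
  refine Eq.trans h3.symm ?_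
  have h1' : MDifferentiableAt 𝓘(ℝ, E) 𝓘(ℝ, E) (extChartAt 𝓘(ℝ, E) (1 : G)) (g * 1) := by
    rwa [mul_one]
  rw [(h1'.comp (1 : G) h2).mfderiv, modelWithCornersSelf_coe, range_id]
  exact congrArg (fun T : E →L[ℝ] E => T V) (congrFun fderivWithin_univ _)

theorem bracket_eq_lieBracket (W Z : GroupLieAlgebra 𝓘(ℝ, E) G) :
    ⁅W, Z⁆ = lieBracket ℝ
        (fun y => fderiv ℝ (fun x => chartMul E G (y, x)) (chartOne E G) W)
        (fun y => fderiv ℝ (fun x => chartMul E G (y, x)) (chartOne E G) Z) (chartOne E G) := by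
  have hev : ∀ V : GroupLieAlgebra 𝓘(ℝ, E) G,
      mpullbackWithin 𝓘(ℝ, E) 𝓘(ℝ, E) (extChartAt 𝓘(ℝ, E) (1 : G)).symm
      (mulInvariantVectorField V) (range 𝓘(ℝ, E)) =ᶠ[𝓝 (chartOne E G)]
      fun y => fderiv ℝ (fun x => chartMul E G (y, x)) (chartOne E G) V := by
    intro V
    filter_upwards [extChartAt_target_mem_nhds (I := 𝓘(ℝ, E)) (1 : G)] with y hy
    exact mpullbackWithin_mulInvariantVectorField V hy
  rw [GroupLieAlgebra.bracket_def, mlieBracket, mlieBracketWithin_apply, mfderiv_extChartAt_self]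
  refine (congrArg (fun T : E →L[ℝ] E => T _) ContinuousLinearMap.inverse_id).trans ?_
  rw [← (hev W).lieBracket_vectorField_eq (hev Z)]
  have hs : (extChartAt 𝓘(ℝ, E) (1 : G)).symm ⁻¹' univ ∩ range 𝓘(ℝ, E) = univ := by
    rw [modelWithCornersSelf_coe, range_id, preimage_univ, inter_self]
  exact (congrArg (fun s => lieBracketWithin ℝ _ _ s (chartOne E G)) hs).trans
    (congrFun lieBracketWithin_univ _)

/-- The bracket of the Lie algebra is the derivative at the identity of the adjoint representation,
read in the chart at the identity. -/
theorem fderiv_chartConj_eq_bracket (W Z : GroupLieAlgebra 𝓘(ℝ, E) G) :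
    fderiv ℝ (fun y => fderiv ℝ (fun x => chartConj E G (y, x)) (chartOne E G)) (chartOne E G) W Z =
      ⁅W, Z⁆ := by
  have hnhds : (extChartAt 𝓘(ℝ, E) (1 : G)).target ∈ 𝓝 (chartOne E G) :=
    extChartAt_target_mem_nhds 1
  rw [bracket_eq_lieBracket]
  refine fderiv_conjugation_eq_lieBracket (M := chartMul E G) (C := chartConj E G)
    (e := chartOne E G) (contDiffAt_chartMul.of_le ENat.LEInfty.out)
    (contDiffAt_chartConj.of_le ENat.LEInfty.out) ?_ ?_ ?_ ?_ ?_ W Z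
  · filter_upwards [hnhds] with y hy
    simp only [chartMul, symm_chartOne, mul_one, (extChartAt 𝓘(ℝ, E) (1 : G)).right_inv hy]
  · filter_upwards [hnhds] with y hy
    simp only [chartMul, symm_chartOne, one_mul, (extChartAt 𝓘(ℝ, E) (1 : G)).right_inv hy]
  · filter_upwards [hnhds] with y hy
    simp only [chartConj, symm_chartOne, mul_one, mul_inv_cancel]
    rfl
  · filter_upwards [hnhds] with y hy
    simp only [chartConj, symm_chartOne, one_mul, inv_one, mul_one,
      (extChartAt 𝓘(ℝ, E) (1 : G)).right_inv hy]
  · have hc : ContinuousAt (fun p : E × E => (extChartAt 𝓘(ℝ, E) (1 : G)).symm p.1 *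
        (extChartAt 𝓘(ℝ, E) (1 : G)).symm p.2 * ((extChartAt 𝓘(ℝ, E) (1 : G)).symm p.1)⁻¹)
        (chartOne E G, chartOne E G) :=
      ((contMDiffAt_symm_fst.mul contMDiffAt_symm_snd).mul contMDiffAt_symm_fst.inv).continuousAt
    have hs : ∀ᶠ p in 𝓝 (chartOne E G, chartOne E G),
        (extChartAt 𝓘(ℝ, E) (1 : G)).symm p.1 * (extChartAt 𝓘(ℝ, E) (1 : G)).symm p.2 *
          ((extChartAt 𝓘(ℝ, E) (1 : G)).symm p.1)⁻¹ ∈ (extChartAt 𝓘(ℝ, E) (1 : G)).source := by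
      refine hc.eventually_mem ?_
      rw [symm_chartOne, mul_one, inv_one, mul_one]
      exact extChartAt_source_mem_nhds 1
    filter_upwards [hs] with p hp
    simp only [chartMul, chartConj]
    rw [(extChartAt 𝓘(ℝ, E) (1 : G)).left_inv hp, inv_mul_cancel_right]

theorem contDiffAt_fderiv_chartConj :
    ContDiffAt ℝ ∞ (fun y => fderiv ℝ (fun x => chartConj E G (y, x)) (chartOne E G))
      (chartOne E G) := by
  refine ContDiffAt.fderiv (n := ∞) (f := fun y x => chartConj E G (y, x))
    (g := fun _ => chartOne E G) ?_ contDiffAt_const (by simp)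
  exact contDiffAt_chartConj

theorem Ad_eventuallyEq :
    (Ad : G → E →L[ℝ] E) =ᶠ[𝓝 (1 : G)]
      (fun y => fderiv ℝ (fun x => chartConj E G (y, x)) (chartOne E G)) ∘
        extChartAt 𝓘(ℝ, E) (1 : G) := by
  filter_upwards [extChartAt_source_mem_nhds (I := 𝓘(ℝ, E)) (1 : G)] with g hg
  exact Ad_eq_fderiv hg

/-- `Ad` is smooth at the identity, as a partial derivative of the conjugation in the chart, and
hence everywhere by multiplicativity. -/
theorem contMDiff_Ad : ContMDiff 𝓘(ℝ, E) 𝓘(ℝ, E →L[ℝ] E) ∞ (Ad : G → E →L[ℝ] E) := by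
  have h1 : ContMDiffAt 𝓘(ℝ, E) 𝓘(ℝ, E →L[ℝ] E) ∞ (Ad : G → E →L[ℝ] E) 1 := by
    refine ContMDiffAt.congr_of_eventuallyEq ?_ Ad_eventuallyEq
    exact ContMDiffAt.comp (1 : G) contDiffAt_fderiv_chartConj.contMDiffAt contMDiffAt_extChartAt
  intro g
  have h2 : (Ad : G → E →L[ℝ] E) = fun h => (Ad g).comp (Ad (g⁻¹ * h)) := by
    ext1 h
    rw [← Ad_mul, mul_inv_cancel_left]
  rw [h2]
  have h3 : ContMDiffAt 𝓘(ℝ, E) 𝓘(ℝ, E →L[ℝ] E) ∞ (fun h : G => Ad (E := E) (g⁻¹ * h)) g := by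
    refine ContMDiffAt.comp (g := (Ad : G → E →L[ℝ] E)) g ?_ contMDiff_mul_left.contMDiffAt
    rwa [inv_mul_cancel]
  exact contMDiffAt_const.clm_comp h3

variable (E G) in
/-- The bracket of the Lie algebra of `G` as a continuous bilinear map on the model space: the
derivative of `Ad` at the identity. -/
def adL : E →L[ℝ] E →L[ℝ] E :=
  fderiv ℝ (fun y => fderiv ℝ (fun x => chartConj E G (y, x)) (chartOne E G)) (chartOne E G)

theorem adL_apply (W Z : GroupLieAlgebra 𝓘(ℝ, E) G) : adL E G W Z = ⁅W, Z⁆ :=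
  fderiv_chartConj_eq_bracket W Z

theorem hasMFDerivAt_Ad_one :
    HasMFDerivAt 𝓘(ℝ, E) 𝓘(ℝ, E →L[ℝ] E) (Ad : G → E →L[ℝ] E) 1 (adL E G) := by
  refine HasMFDerivAt.congr_of_eventuallyEq ?_ Ad_eventuallyEq
  have h1 : HasMFDerivAt 𝓘(ℝ, E) 𝓘(ℝ, E) (extChartAt 𝓘(ℝ, E) (1 : G)) 1
      (ContinuousLinearMap.id ℝ E) := by
    have h := (mdifferentiableAt_extChartAt (I := 𝓘(ℝ, E)) (mem_chart_source E (1 : G))).hasMFDerivAt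
    rwa [mfderiv_extChartAt_self] at h
  have h2 := (contDiffAt_fderiv_chartConj (E := E) (G := G)).differentiableAt (by simp)
  exact HasMFDerivAt.comp (1 : G) h2.hasFDerivAt.hasMFDerivAt h1

end Adjoint

/-! ### Translations, the derivative of `Ad`, and one-parameter subgroups -/

section OneParameterSubgroups

variable {E : Type*} [NormedAddCommGroup E] [NormedSpace ℝ E] [FiniteDimensional ℝ E]
  {G : Type*} [TopologicalSpace G] [ChartedSpace E G] [Group G] [LieGroup 𝓘(ℝ, E) ∞ G]

open Filter Topology VectorField Set

theorem mdifferentiable_mul_left (g : G) :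
    MDifferentiable 𝓘(ℝ, E) 𝓘(ℝ, E) (fun x : G => g * x) :=
  (contMDiff_mul_left (I := 𝓘(ℝ, E)) (n := ∞) (a := g)).mdifferentiable (by simp)

/-- Left translation by `g` maps a left invariant field to itself. -/
theorem mfderiv_mul_left_mulInvariantVectorField (U : GroupLieAlgebra 𝓘(ℝ, E) G) (g h : G) :
    mfderiv 𝓘(ℝ, E) 𝓘(ℝ, E) (fun x : G => g * x) h (mulInvariantVectorField U h) =
      mulInvariantVectorField U (g * h) := by
  have h1 := mfderiv_comp_apply_of_eq (1 : G) (mdifferentiable_mul_left (E := E) g h)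
    (mdifferentiable_mul_left (E := E) h 1) (mul_one h) U
  have h2 : (fun x : G => g * x) ∘ (fun x : G => h * x) = fun x => g * h * x := by
    ext x
    simp [mul_assoc]
  rw [h2] at h1
  exact h1.symm

theorem leftTriv_mulInvariantVectorField (U : GroupLieAlgebra 𝓘(ℝ, E) G) (g : G) :
    leftTriv g (mulInvariantVectorField U g) = U := by
  have h1 := mfderiv_comp_apply_of_eq (1 : G) (mdifferentiable_mul_left (E := E) g⁻¹ g)
    (mdifferentiable_mul_left (E := E) g 1) (mul_one g) U
  have h2 : (fun x : G => g⁻¹ * x) ∘ (fun x : G => g * x) = id := by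
    ext x
    simp
  rw [h2, mfderiv_id] at h1
  exact h1.symm

theorem hasMFDerivAt_Ad_of_eq_one {x : G} (hx : x = 1) :
    HasMFDerivAt 𝓘(ℝ, E) 𝓘(ℝ, E →L[ℝ] E) (Ad : G → E →L[ℝ] E) x (adL E G) := by
  subst hx
  exact hasMFDerivAt_Ad_one

variable (E) in
/-- The derivative of `Ad` at `g`: it maps `Y` to `Ad g ∘ ad (g⁻¹ Y)`. -/
def adDeriv (g : G) : E →L[ℝ] E →L[ℝ] E :=
  (ContinuousLinearMap.compL ℝ E E E (Ad g)).comp ((adL E G).comp (leftTriv g))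

theorem adDeriv_apply (g : G) (Y : TangentSpace 𝓘(ℝ, E) g) (Z : E) :
    adDeriv E g Y Z = Ad g (adL E G (leftTriv g Y) Z) := rfl

theorem hasMFDerivAt_Ad (g : G) :
    HasMFDerivAt 𝓘(ℝ, E) 𝓘(ℝ, E →L[ℝ] E) (Ad : G → E →L[ℝ] E) g (adDeriv E g) := by
  have h2 : (Ad : G → E →L[ℝ] E) = (ContinuousLinearMap.compL ℝ E E E (Ad g)) ∘
      (Ad ∘ fun h => (g⁻¹ * h)) := by
    ext1 h
    exact (by rw [← Ad_mul, mul_inv_cancel_left] :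
      Ad (E := E) h = (Ad g).comp (Ad (g⁻¹ * h)))
  rw [h2]
  refine HasMFDerivAt.comp g
    (ContinuousLinearMap.compL ℝ E E E (Ad g)).hasFDerivAt.hasMFDerivAt ?_
  exact HasMFDerivAt.comp g (hasMFDerivAt_Ad_of_eq_one (inv_mul_cancel g))
    (mdifferentiable_mul_left g⁻¹ g).hasMFDerivAt

theorem Ad_adL (g : G) (W Z : E) : Ad g (adL E G W Z) = adL E G (Ad g W) (Ad g Z) := by
  have h1 : HasMFDerivAt 𝓘(ℝ, E) 𝓘(ℝ, E →L[ℝ] E)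
      ((Ad : G → E →L[ℝ] E) ∘ fun x : G => g * x * g⁻¹) 1
      ((adL E G).comp (Ad g) : E →L[ℝ] E →L[ℝ] E) :=
    HasMFDerivAt.comp (1 : G) (hasMFDerivAt_Ad_of_eq_one (by group))
      (mdifferentiable_conj g 1).hasMFDerivAt
  have h2 : HasMFDerivAt 𝓘(ℝ, E) 𝓘(ℝ, E →L[ℝ] E)
      (((ContinuousLinearMap.compL ℝ E E E (Ad g)).comp
        ((ContinuousLinearMap.compL ℝ E E E).flip (Ad g⁻¹))) ∘ (Ad : G → E →L[ℝ] E)) 1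
      (((ContinuousLinearMap.compL ℝ E E E (Ad g)).comp
        ((ContinuousLinearMap.compL ℝ E E E).flip (Ad g⁻¹))).comp (adL E G)) :=
    HasMFDerivAt.comp (1 : G) (ContinuousLinearMap.hasFDerivAt _).hasMFDerivAt hasMFDerivAt_Ad_one
  have h3 : ((Ad : G → E →L[ℝ] E) ∘ fun x : G => g * x * g⁻¹) =
      ((ContinuousLinearMap.compL ℝ E E E (Ad g)).comp
        ((ContinuousLinearMap.compL ℝ E E E).flip (Ad g⁻¹))) ∘ (Ad : G → E →L[ℝ] E) := by
    ext1 x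
    exact (by rw [Ad_mul, Ad_mul, ContinuousLinearMap.comp_assoc] :
      Ad (E := E) (g * x * g⁻¹) = (Ad g).comp ((Ad x).comp (Ad g⁻¹)))
  rw [h3] at h1
  have h4 := congrArg (fun T : E →L[ℝ] E →L[ℝ] E => T W (Ad g Z)) (hasMFDerivAt_unique h2 h1)
  have h5 : Ad g⁻¹ (Ad g Z) = Z :=
    congrArg (fun T : E →L[ℝ] E => T Z) (Ad_inv_comp g)
  have h6 : Ad g (adL E G W (Ad g⁻¹ (Ad g Z))) = adL E G (Ad g W) (Ad g Z) := h4
  rwa [h5] at h6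

/-- Right translation to the identity is left translation followed by `Ad`. -/
theorem rightTriv_eq (g : G) (Y : TangentSpace 𝓘(ℝ, E) g) :
    rightTriv g Y = Ad (E := E) g (leftTriv g Y) := by
  have h1 := mfderiv_comp_apply_of_eq g (mdifferentiable_conj (E := E) g 1)
    (mdifferentiable_mul_left (E := E) g⁻¹ g) (inv_mul_cancel g) Y
  have h2 : (fun x : G => g * x * g⁻¹) ∘ (fun x : G => g⁻¹ * x) = fun x => x * g⁻¹ := by
    ext x
    simp
  rw [h2] at h1
  exact h1

theorem contMDiff_mulInvariantVectorField_one (U : GroupLieAlgebra 𝓘(ℝ, E) G) :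
    ContMDiff 𝓘(ℝ, E) 𝓘(ℝ, E).tangent 1
      (fun g : G => (⟨g, mulInvariantVectorField U g⟩ : TangentBundle 𝓘(ℝ, E) G)) :=
  (contMDiff_mulInvariantVectorField U).of_le (by
    rw [minSmoothness_of_isRCLikeNormedField]
    exact one_le_two)

/-- A left translate of an integral curve of a left invariant field is an integral curve. -/
theorem isMIntegralCurveOn_mul_left {U : GroupLieAlgebra 𝓘(ℝ, E) G} {γ : ℝ → G} {s : Set ℝ}
    (hγ : IsMIntegralCurveOn (I := 𝓘(ℝ, E)) γ (mulInvariantVectorField U) s) (g : G) :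
    IsMIntegralCurveOn (I := 𝓘(ℝ, E)) (fun t => g * γ t) (mulInvariantVectorField U) s := by
  intro t ht
  have h1 := HasMFDerivAt.comp_hasMFDerivWithinAt t
    (mdifferentiable_mul_left (E := E) g (γ t)).hasMFDerivAt (hγ t ht)
  refine h1.congr_mfderiv ?_
  rw [← mfderiv_mul_left_mulInvariantVectorField]
  exact ContinuousLinearMap.ext fun r : ℝ =>
    (mfderiv 𝓘(ℝ, E) 𝓘(ℝ, E) (fun x : G => g * x) (γ t)).map_smul r
      (mulInvariantVectorField U (γ t))

/-- Left invariant fields are complete: by left translation, the domains of local integral curves may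
be chosen of the same length at all points. -/
theorem exists_isMIntegralCurve_mulInvariantVectorField [T2Space G]
    (U : GroupLieAlgebra 𝓘(ℝ, E) G) :
    ∃ γ : ℝ → G, γ 0 = 1 ∧ IsMIntegralCurve (I := 𝓘(ℝ, E)) γ (mulInvariantVectorField U) := by
  have hv := contMDiff_mulInvariantVectorField_one U
  obtain ⟨γ, h0, hγ⟩ := exists_isMIntegralCurveAt_of_contMDiffAt_boundaryless (I := 𝓘(ℝ, E)) 0
    (hv.contMDiffAt (x := (1 : G)))
  obtain ⟨ε, hε, h1⟩ := isMIntegralCurveAt_iff'.mp hγ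
  rw [Real.ball_eq_Ioo, zero_sub, zero_add] at h1
  refine exists_isMIntegralCurve_of_isMIntegralCurveOn hv hε (fun x => ?_) 1
  exact ⟨fun t => x * γ t, by simp [h0], isMIntegralCurveOn_mul_left h1 x⟩

/-- The one-parameter subgroup with initial velocity `U`. -/
def oneParam [T2Space G] (U : GroupLieAlgebra 𝓘(ℝ, E) G) : ℝ → G :=
  (exists_isMIntegralCurve_mulInvariantVectorField U).choose

variable [T2Space G]

theorem oneParam_zero (U : GroupLieAlgebra 𝓘(ℝ, E) G) : oneParam U 0 = 1 :=
  (exists_isMIntegralCurve_mulInvariantVectorField U).choose_spec.1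

theorem isMIntegralCurve_oneParam (U : GroupLieAlgebra 𝓘(ℝ, E) G) :
    IsMIntegralCurve (I := 𝓘(ℝ, E)) (oneParam U) (mulInvariantVectorField U) :=
  (exists_isMIntegralCurve_mulInvariantVectorField U).choose_spec.2

theorem eq_oneParam {U : GroupLieAlgebra 𝓘(ℝ, E) G} {γ : ℝ → G} (h0 : γ 0 = 1)
    (hγ : IsMIntegralCurve (I := 𝓘(ℝ, E)) γ (mulInvariantVectorField U)) : γ = oneParam U :=
  isMIntegralCurve_Ioo_eq_of_contMDiff_boundaryless (t₀ := 0)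
    (contMDiff_mulInvariantVectorField_one U) hγ (isMIntegralCurve_oneParam U)
    (by rw [h0, oneParam_zero])

theorem isExp_iff {U : GroupLieAlgebra 𝓘(ℝ, E) G} {g : G} : IsExp U g ↔ oneParam U 1 = g := by
  constructor
  · rintro ⟨γ, h0, hγ, h1⟩
    rw [← eq_oneParam h0 hγ, h1]
  · rintro h
    exact ⟨oneParam U, oneParam_zero U, isMIntegralCurve_oneParam U, h⟩

theorem oneParam_add (U : GroupLieAlgebra 𝓘(ℝ, E) G) (s t : ℝ) :
    oneParam U (s + t) = oneParam U s * oneParam U t := by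
  have h1 := isMIntegralCurve_oneParam U
  have h2 : IsMIntegralCurve (I := 𝓘(ℝ, E)) (fun t => (oneParam U s)⁻¹ * oneParam U (t + s))
      (mulInvariantVectorField U) := by
    rw [isMIntegralCurve_iff_isMIntegralCurveOn]
    exact isMIntegralCurveOn_mul_left ((h1.comp_add s).isMIntegralCurveOn univ) _
  have h3 := congrFun (eq_oneParam (by simp) h2) t
  rw [← h3, add_comm t s, mul_inv_cancel_left]

theorem oneParam_smul (c : ℝ) (U : GroupLieAlgebra 𝓘(ℝ, E) G) (t : ℝ) :
    oneParam (c • U) t = oneParam U (t * c) := by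
  have h1 := (isMIntegralCurve_oneParam U).comp_mul c
  rw [← mulInvariantVectorField_smul] at h1
  have h2 := eq_oneParam (by simp [oneParam_zero]) h1
  rw [← h2]
  rfl

theorem oneParam_natCast_mul (U : GroupLieAlgebra 𝓘(ℝ, E) G) (k : ℕ) (t : ℝ) :
    oneParam U (k * t) = oneParam U t ^ k := by
  induction k with
  | zero => simp [oneParam_zero]
  | succ k ih => rw [Nat.cast_succ, add_mul, one_mul, oneParam_add, ih, pow_succ]

theorem hasDerivAt_Ad_oneParam (U : GroupLieAlgebra 𝓘(ℝ, E) G) (t : ℝ) :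
    HasDerivAt (fun t => Ad (E := E) (oneParam U t))
      ((Ad (oneParam U t) : E →L[ℝ] E) * adL E G U) t := by
  have h1 := HasMFDerivAt.comp t (hasMFDerivAt_Ad (E := E) (oneParam U t))
    (isMIntegralCurve_oneParam U t)
  let v : E := mulInvariantVectorField U (oneParam U t)
  have h2 : HasFDerivAt (fun t => Ad (E := E) (oneParam U t))
      ((adDeriv E (oneParam U t)).comp ((1 : ℝ →L[ℝ] ℝ).smulRight v)) t :=
    hasMFDerivAt_iff_hasFDerivAt.mp h1
  refine h2.hasDerivAt.congr_deriv ?_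
  have h3 : adDeriv E (oneParam U t) (mulInvariantVectorField U (oneParam U t)) =
      (Ad (oneParam U t) : E →L[ℝ] E) * adL E G U := by
    ext Z
    rw [adDeriv_apply, leftTriv_mulInvariantVectorField]
    rfl
  rw [← h3]
  change adDeriv E (oneParam U t) ((1 : ℝ) • mulInvariantVectorField U (oneParam U t)) = _
  rw [one_smul]

/-- Both sides solve the same linear differential equation: the product of the left side with the
inverse of the right side has derivative `0`. -/
theorem Ad_oneParam (U : GroupLieAlgebra 𝓘(ℝ, E) G) (t : ℝ) :
    Ad (E := E) (oneParam U t) = NormedSpace.exp (t • adL E G U) := by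
  have : CompleteSpace E := FiniteDimensional.complete ℝ E
  set A : E →L[ℝ] E := adL E G U with hA
  have h1 : ∀ s : ℝ, HasDerivAt
      (fun s => Ad (E := E) (oneParam U s) * NormedSpace.exp (s • (-A))) 0 s := by
    intro s
    have h2 := (hasDerivAt_Ad_oneParam U s).mul (hasDerivAt_exp_smul_const' (-A) s)
    refine h2.congr_deriv ?_
    rw [← hA, mul_assoc, ← mul_add, ← add_mul, add_neg_cancel, zero_mul, mul_zero]
  have h3 : Ad (E := E) (oneParam U t) * NormedSpace.exp (t • (-A)) = 1 := by
    have h4 := is_const_of_deriv_eq_zero (fun s => (h1 s).differentiableAt)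
      (fun s => (h1 s).deriv) t 0
    refine h4.trans ?_
    rw [zero_smul, NormedSpace.exp_zero, oneParam_zero, Ad_one]
    rfl
  have h5 : NormedSpace.exp (t • (-A)) * NormedSpace.exp (t • A) = 1 := by
    let _ : NormedAlgebra ℚ (E →L[ℝ] E) := NormedAlgebra.restrictScalars ℚ ℝ (E →L[ℝ] E)
    rw [← NormedSpace.exp_add_of_commute, smul_neg, neg_add_cancel, NormedSpace.exp_zero]
    rw [smul_neg]
    exact (Commute.refl _).neg_left
  calc Ad (E := E) (oneParam U t)
      = Ad (E := E) (oneParam U t) * (NormedSpace.exp (t • (-A)) * NormedSpace.exp (t • A)) := by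
        rw [h5, mul_one]
    _ = NormedSpace.exp (t • A) := by rw [← mul_assoc, h3, one_mul]

end OneParameterSubgroups

/-! ### Smoothness of the exponential map -/

section ExponentialMap

variable {E : Type*} [NormedAddCommGroup E] [NormedSpace ℝ E] [FiniteDimensional ℝ E]
  {G : Type*} [TopologicalSpace G] [ChartedSpace E G] [Group G] [LieGroup 𝓘(ℝ, E) ∞ G]

open Filter Topology VectorField Set

theorem contDiff_exp_clm : ContDiff ℝ ∞ (NormedSpace.exp : (E →L[ℝ] E) → (E →L[ℝ] E)) := by
  have : CompleteSpace E := FiniteDimensional.complete ℝ E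
  exact contDiff_iff_contDiffAt.mpr fun x => (NormedSpace.exp_analytic (𝕂 := ℝ) x).contDiffAt

/-- When the Lie algebra has trivial centre, `Ad` followed by a suitable linear map is a local
diffeomorphism at the identity. -/
theorem exists_localChart_Ad (hinj : Function.Injective (adL E G)) :
    ∃ (A : (E →L[ℝ] E) →L[ℝ] E) (Θ : OpenPartialHomeomorph G E), 1 ∈ Θ.source ∧
      (∀ g ∈ Θ.source, Θ g = A (Ad g)) ∧
      ContMDiffAt 𝓘(ℝ, E) 𝓘(ℝ, E) ∞ Θ.symm (Θ 1) := by
  obtain ⟨A', hA'⟩ := LinearMap.exists_leftInverse_of_injective (adL E G).toLinearMap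
    (LinearMap.ker_eq_bot.mpr hinj)
  let A : (E →L[ℝ] E) →L[ℝ] E := LinearMap.toContinuousLinearMap A'
  have hA : A.comp (adL E G) = ContinuousLinearMap.id ℝ E := by
    ext W
    exact LinearMap.congr_fun hA' W
  let f : E → E := fun y => A (fderiv ℝ (fun x => chartConj E G (y, x)) (chartOne E G))
  have hf : ContDiffAt ℝ ∞ f (chartOne E G) :=
    A.contDiff.contDiffAt.comp (chartOne E G) contDiffAt_fderiv_chartConj
  have hf' : HasFDerivAt f ((ContinuousLinearEquiv.refl ℝ E : E ≃L[ℝ] E) : E →L[ℝ] E)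
      (chartOne E G) := by
    have h := A.hasFDerivAt.comp (chartOne E G)
      ((contDiffAt_fderiv_chartConj (E := E) (G := G)).differentiableAt (by simp)).hasFDerivAt
    exact h.congr_fderiv hA
  have hn : (∞ : WithTop ℕ∞) ≠ 0 := by simp
  let T := hf.toOpenPartialHomeomorph f hf' hn
  have hT0 : chartOne E G ∈ T.source := hf.mem_toOpenPartialHomeomorph_source hf' hn
  have hTf : ∀ y, T y = f y := fun _ => rfl
  have hc1 : chartAt E (1 : G) 1 = chartOne E G := by simp [chartOne]
  have h1 : (1 : G) ∈ ((chartAt E (1 : G)).trans T).source := by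
    rw [OpenPartialHomeomorph.trans_source]
    refine ⟨mem_chart_source E 1, ?_⟩
    rw [mem_preimage, hc1]
    exact hT0
  refine ⟨A, (chartAt E (1 : G)).trans T, h1, ?_, ?_⟩
  · intro g hg
    rw [OpenPartialHomeomorph.trans_source] at hg
    have hg' : g ∈ (extChartAt 𝓘(ℝ, E) (1 : G)).source := by
      rw [extChartAt_source]
      exact hg.1
    rw [Ad_eq_fderiv hg']
    simp [hTf, f]
  · have h2 : ContMDiffAt 𝓘(ℝ, E) 𝓘(ℝ, E) ∞ T.symm (f (chartOne E G)) :=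
      (hf.to_localInverse hf' hn).contMDiffAt
    have h3 : T.symm (f (chartOne E G)) = chartOne E G := T.left_inv hT0
    have h4 : ContMDiffAt 𝓘(ℝ, E) 𝓘(ℝ, E) ∞ (chartAt E (1 : G)).symm (chartOne E G) := by
      have h := contMDiffAt_symm_chartOne (E := E) (G := G)
      simpa using h
    rw [OpenPartialHomeomorph.coe_trans, Function.comp_apply, hc1, hTf,
      OpenPartialHomeomorph.coe_trans_symm]
    refine ContMDiffAt.comp _ ?_ h2
    rw [h3]
    exact h4

variable [T2Space G]

/-- The exponential map of `G`, on the model space. -/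
def expMap (U : E) : G :=
  oneParam (E := E) (G := G) U 1

theorem continuous_oneParam (U : GroupLieAlgebra 𝓘(ℝ, E) G) : Continuous (oneParam U) :=
  continuous_iff_continuousAt.mpr fun t => (isMIntegralCurve_oneParam U t).1

/-- If the curve `t ↦ exp (t ad U)`, seen through the chart `Θ = A ∘ Ad`, stays in the target of the
chart, then lifting it through the chart computes `exp U`. As `Ad` is not injective on `G`, one has
to follow the curve `t ↦ exp (t U)` from `t = 0`: the set of times at which it lies in the source is
open, and it is closed because the lift is continuous. -/
theorem expMap_eq_symm (A : (E →L[ℝ] E) →L[ℝ] E) (Θ : OpenPartialHomeomorph G E)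
    (h1 : 1 ∈ Θ.source) (hΘ : ∀ g ∈ Θ.source, Θ g = A (Ad g)) {U : E}
    (hU : ∀ t ∈ Icc (0 : ℝ) 1, A (NormedSpace.exp (t • adL E G U)) ∈ Θ.target) :
    expMap U = Θ.symm (A (NormedSpace.exp (adL E G U))) := by
  have : CompleteSpace E := FiniteDimensional.complete ℝ E
  set a : ℝ → G := oneParam (E := E) (G := G) U with ha
  have hac : Continuous a := continuous_oneParam (E := E) (G := G) U
  set c : ℝ → E := fun t => A (NormedSpace.exp (t • adL E G U)) with hc
  have hcc : Continuous c :=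
    A.continuous.comp (contDiff_exp_clm.continuous.comp (continuous_id.smul continuous_const))
  have hAd : ∀ t, A (Ad (a t)) = c t := fun t =>
    congrArg A (Ad_oneParam (E := E) (G := G) U t)
  have ha0 : a 0 = 1 := oneParam_zero (E := E) (G := G) U
  set u : Set ℝ := a ⁻¹' Θ.source ∩ c ⁻¹' Θ.target with hu
  have huo : IsOpen u := (Θ.open_source.preimage hac).inter (Θ.open_target.preimage hcc)
  have heq : ∀ t ∈ u, a t = Θ.symm (c t) := by
    intro t ht
    rw [← hAd, ← hΘ _ ht.1, Θ.left_inv ht.1]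
  have hsub : Icc (0 : ℝ) 1 ⊆ u := by
    refine isPreconnected_Icc.subset_of_closure_inter_subset huo ⟨0, by simp, ?_, hU 0 (by simp)⟩ ?_
    · rw [mem_preimage, ha0]
      exact h1
    · rintro t ⟨ht, ht'⟩
      have hne : (𝓝[u] t).NeBot := mem_closure_iff_nhdsWithin_neBot.mp ht
      have h2 : Tendsto a (𝓝[u] t) (𝓝 (a t)) := hac.continuousAt.continuousWithinAt
      have h3 : Tendsto (fun t => Θ.symm (c t)) (𝓝[u] t) (𝓝 (Θ.symm (c t))) :=
        (ContinuousAt.comp (f := c) (Θ.continuousAt_symm (hU t ht'))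
          hcc.continuousAt).continuousWithinAt
      have h4 : Tendsto a (𝓝[u] t) (𝓝 (Θ.symm (c t))) :=
        h3.congr' (by filter_upwards [self_mem_nhdsWithin] with s hs using (heq s hs).symm)
      have h5 := tendsto_nhds_unique h2 h4
      refine ⟨?_, hU t ht'⟩
      rw [mem_preimage, h5]
      exact Θ.map_target (hU t ht')
  have h6 := heq 1 (hsub (by simp))
  simp only [hc, one_smul] at h6
  exact h6

/-- Near `0`, the exponential map is `U ↦ exp (ad U)` followed by a local inverse of `Ad`. -/
theorem contMDiffAt_expMap_zero (hinj : Function.Injective (adL E G)) :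
    ContMDiffAt 𝓘(ℝ, E) 𝓘(ℝ, E) ∞ (expMap : E → G) 0 := by
  obtain ⟨A, Θ, h1, hΘ, hs⟩ := exists_localChart_Ad hinj
  set F : E → E := fun U => A (NormedSpace.exp (adL E G U)) with hF
  have hFc : ContDiff ℝ ∞ F :=
    A.contDiff.comp (contDiff_exp_clm.comp (adL E G).contDiff)
  have hF0 : F 0 = Θ 1 := by
    rw [hF, hΘ 1 h1, Ad_one]
    simp only [map_zero, NormedSpace.exp_zero]
    rfl
  have hmem : F ⁻¹' Θ.target ∈ 𝓝 (0 : E) := by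
    refine hFc.continuous.continuousAt.preimage_mem_nhds (Θ.open_target.mem_nhds ?_)
    rw [hF0]
    exact Θ.map_source h1
  obtain ⟨r, hr, hball⟩ := Metric.mem_nhds_iff.mp hmem
  have heq : (expMap : E → G) =ᶠ[𝓝 0] Θ.symm ∘ F := by
    filter_upwards [Metric.ball_mem_nhds (0 : E) hr] with U hU
    refine expMap_eq_symm A Θ h1 hΘ fun t ht => ?_
    have h2 : t • U ∈ Metric.ball (0 : E) r := by
      rw [mem_ball_zero_iff] at hU ⊢
      rw [norm_smul, Real.norm_of_nonneg ht.1]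
      exact (mul_le_of_le_one_left (norm_nonneg U) ht.2).trans_lt hU
    have h3 := hball h2
    simp only [mem_preimage, hF, map_smul] at h3
    exact h3
  refine ContMDiffAt.congr_of_eventuallyEq ?_ heq
  refine ContMDiffAt.comp (0 : E) ?_ hFc.contMDiff.contMDiffAt
  rwa [hF0]

theorem expMap_eq_pow (U : E) {k : ℕ} (hk : k ≠ 0) :
    (expMap U : G) = expMap ((k : ℝ)⁻¹ • U) ^ k := by
  have h1 := oneParam_natCast_mul (E := E) (G := G) ((k : ℝ)⁻¹ • U) k 1
  have h2 := oneParam_smul (E := E) (G := G) (k : ℝ)⁻¹ U ((k : ℝ) * 1)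
  have h3 : (k : ℝ) * 1 * (k : ℝ)⁻¹ = 1 := by field_simp
  exact (congrArg (oneParam (E := E) (G := G) U) h3).symm.trans (h2.symm.trans h1)

/-- The exponential map is smooth near `0`, hence everywhere, as `exp U` is the `k`-th power of
`exp (U / k)`. -/
theorem contMDiff_expMap (hinj : Function.Injective (adL E G)) :
    ContMDiff 𝓘(ℝ, E) 𝓘(ℝ, E) ∞ (expMap : E → G) := by
  rw [contMDiff_infty]
  intro n U
  have h1 : ∀ᶠ V in 𝓝 (0 : E), ContMDiffAt 𝓘(ℝ, E) 𝓘(ℝ, E) n (expMap : E → G) V :=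
    (contMDiffAt_iff_contMDiffAt_nhds (by simp)).mp
      ((contMDiffAt_expMap_zero hinj).of_le ENat.LEInfty.out)
  have hG : LieGroup 𝓘(ℝ, E) (n : WithTop ℕ∞) G := LieGroup.of_le (n := ∞) ENat.LEInfty.out
  have h2 : Tendsto (fun k : ℕ => (k : ℝ)⁻¹ • U) atTop (𝓝 0) := by
    have h := (tendsto_inv_atTop_nhds_zero_nat (𝕜 := ℝ)).smul_const U
    rwa [zero_smul] at h
  -- For large `k` the point `U / k` lies in the neighbourhood of `0` where the map is smooth.
  obtain ⟨k, hk, hk0⟩ := ((h2.eventually h1).and (eventually_ne_atTop 0)).exists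
  have h3 : (expMap : E → G) = fun V => expMap ((k : ℝ)⁻¹ • V) ^ k := by
    ext1 V
    exact expMap_eq_pow V hk0
  rw [h3]
  have h4 : ContMDiffAt 𝓘(ℝ, E) 𝓘(ℝ, E) n (fun V : E => (expMap ((k : ℝ)⁻¹ • V) : G)) U :=
    ContMDiffAt.comp (g := (expMap : E → G)) U hk (contDiff_const_smul _).contMDiff.contMDiffAt
  have h5 : ∀ j : ℕ, ContMDiffAt 𝓘(ℝ, E) 𝓘(ℝ, E) n
      (fun V : E => (expMap ((k : ℝ)⁻¹ • V) : G) ^ j) U := by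
    intro j
    induction j with
    | zero => simpa only [pow_zero] using contMDiffAt_const
    | succ j ih =>
      simp only [pow_succ]
      exact ih.mul h4
  exact h5 k

end ExponentialMap

/-! ### The filtration by eigenspaces and the inversion of `U ↦ X - exp (ad U) X` -/

section Filtration

open Filter Topology Set

variable {E : Type*} [NormedAddCommGroup E] [NormedSpace ℝ E]

/-- The sum of the eigenspaces of `D` for the eigenvalues that are at least `s`. -/
def eigenFil (D : E →L[ℝ] E) (s : ℝ) : Submodule ℝ E :=
  ⨆ μ : {μ : ℝ // s ≤ μ}, Module.End.eigenspace D.toLinearMap μ.1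

theorem mem_eigenFil {D : E →L[ℝ] E} {s μ : ℝ} (h : s ≤ μ) {v : E} (hv : D v = μ • v) :
    v ∈ eigenFil D s :=
  Submodule.mem_iSup_of_mem (⟨μ, h⟩ : {μ : ℝ // s ≤ μ}) (Module.End.mem_eigenspace_iff.mpr hv)

theorem eigenFil_le {D : E →L[ℝ] E} {s : ℝ} {p : Submodule ℝ E}
    (h : ∀ μ, s ≤ μ → ∀ v, D v = μ • v → v ∈ p) : eigenFil D s ≤ p :=
  iSup_le fun μ _ hv => h μ.1 μ.2 _ (Module.End.mem_eigenspace_iff.mp hv)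

theorem eigenFil_antitone (D : E →L[ℝ] E) : Antitone (eigenFil D) := fun _ _ h =>
  eigenFil_le fun _ hμ _ hv => mem_eigenFil (h.trans hμ) hv

theorem apply_mem_eigenFil {D : E →L[ℝ] E} {s : ℝ} {v : E} (hv : v ∈ eigenFil D s) :
    D v ∈ eigenFil D s := by
  have h : eigenFil D s ≤ (eigenFil D s).comap D.toLinearMap := by
    refine eigenFil_le fun μ hμ w hw => ?_
    rw [Submodule.mem_comap, ContinuousLinearMap.coe_coe, hw]
    exact Submodule.smul_mem _ _ (mem_eigenFil hμ hw)
  exact h hv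

theorem exists_apply_eq_of_mem_eigenFil {D : E →L[ℝ] E} {s : ℝ} (hs : 0 < s) {v : E}
    (hv : v ∈ eigenFil D s) : ∃ w ∈ eigenFil D s, D w = v := by
  have h : eigenFil D s ≤ (eigenFil D s).map D.toLinearMap := by
    refine eigenFil_le fun μ hμ w hw => ⟨μ⁻¹ • w, Submodule.smul_mem _ _ (mem_eigenFil hμ hw), ?_⟩
    rw [ContinuousLinearMap.coe_coe, map_smul, hw, smul_smul, inv_mul_cancel₀ (hs.trans_le hμ).ne',
      one_smul]
  exact h hv

variable [FiniteDimensional ℝ E]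

theorem exists_eigenFil_eq_bot (D : E →L[ℝ] E) : ∃ M : ℝ, ∀ s, M < s → eigenFil D s = ⊥ := by
  obtain ⟨M, hM⟩ := (Module.End.finite_hasEigenvalue D.toLinearMap).bddAbove
  refine ⟨M, fun s hs => le_bot_iff.mp (eigenFil_le fun μ hμ v hv => ?_)⟩
  by_contra hne
  have h1 : Module.End.HasEigenvalue D.toLinearMap μ :=
    Module.End.hasEigenvalue_of_hasEigenvector (x := v)
      ⟨Module.End.mem_eigenspace_iff.mpr hv, fun h0 => hne (by simp [h0])⟩
  exact absurd (hM h1) (not_le.mpr (hs.trans_le hμ))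

/-- The sum of the eigenspaces for the positive eigenvalues is a member of the filtration. -/
theorem exists_iSup_eigenspace_pos_eq (D : E →L[ℝ] E) : ∃ δ : ℝ, 0 < δ ∧
    (⨆ μ : {μ : ℝ // 0 < μ}, Module.End.eigenspace D.toLinearMap μ.1) = eigenFil D δ := by
  have hfin : ({μ | Module.End.HasEigenvalue D.toLinearMap μ} ∩ Ioi (0 : ℝ)).Finite :=
    (Module.End.finite_hasEigenvalue D.toLinearMap).inter_of_left _
  obtain ⟨δ, hδ, hle⟩ : ∃ δ : ℝ, 0 < δ ∧
      ∀ μ ∈ {μ | Module.End.HasEigenvalue D.toLinearMap μ} ∩ Ioi (0 : ℝ), δ ≤ μ := by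
    rcases ({μ | Module.End.HasEigenvalue D.toLinearMap μ} ∩ Ioi (0 : ℝ)).eq_empty_or_nonempty
      with h | h
    · exact ⟨1, one_pos, by simp [h]⟩
    · obtain ⟨δ, hδ, hmin⟩ := hfin.exists_minimalFor id _ h
      exact ⟨δ, hδ.2, fun μ hμ => (le_total δ μ).elim id fun h' => hmin hμ h'⟩
  refine ⟨δ, hδ, le_antisymm (iSup_le fun μ v hv => ?_) (eigenFil_le fun μ hμ v hv => ?_)⟩
  · by_cases h0 : v = 0
    · rw [h0]
      exact zero_mem _
    · refine mem_eigenFil (hle μ.1 ⟨?_, μ.2⟩) (Module.End.mem_eigenspace_iff.mp hv)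
      exact Module.End.hasEigenvalue_of_hasEigenvector (x := v) ⟨hv, h0⟩
  · exact Submodule.mem_iSup_of_mem (⟨μ, hδ.trans_le hμ⟩ : {μ : ℝ // 0 < μ})
      (Module.End.mem_eigenspace_iff.mpr hv)

/-- A linear map that inverts `D` on the sum of the eigenspaces for the positive eigenvalues. -/
theorem exists_inverse_on_eigenFil (D : E →L[ℝ] E) {δ : ℝ} (hδ : 0 < δ) :
    ∃ K : E →L[ℝ] E, (∀ v ∈ eigenFil D δ, D (K v) = v) ∧ (∀ v ∈ eigenFil D δ, K (D v) = v) ∧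
      ∀ s, δ ≤ s → ∀ v ∈ eigenFil D s, K v ∈ eigenFil D s := by
  let Dr : eigenFil D δ →ₗ[ℝ] eigenFil D δ :=
    D.toLinearMap.restrict fun v hv => apply_mem_eigenFil hv
  have hsurj : Function.Surjective Dr := fun v => by
    obtain ⟨w, hw, hwv⟩ := exists_apply_eq_of_mem_eigenFil hδ v.2
    exact ⟨⟨w, hw⟩, Subtype.ext hwv⟩
  have hinj : Function.Injective Dr := LinearMap.injective_iff_surjective.mpr hsurj
  let e := LinearEquiv.ofBijective Dr ⟨hinj, hsurj⟩
  obtain ⟨p, hp⟩ := LinearMap.exists_leftInverse_of_injective (eigenFil D δ).subtype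
    (Submodule.ker_subtype _)
  let K : E →L[ℝ] E := LinearMap.toContinuousLinearMap
    ((eigenFil D δ).subtype ∘ₗ e.symm.toLinearMap ∘ₗ p)
  have hK : ∀ v ∈ eigenFil D δ, K (D v) = v := by
    intro v hv
    have h1 : p (D v) = e ⟨v, hv⟩ := LinearMap.congr_fun hp (Dr ⟨v, hv⟩)
    change ((e.symm (p (D v)) : eigenFil D δ) : E) = v
    rw [h1, LinearEquiv.symm_apply_apply]
  refine ⟨K, fun v hv => ?_, hK, fun s hs v hv => ?_⟩
  · obtain ⟨w, hw, rfl⟩ := exists_apply_eq_of_mem_eigenFil hδ hv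
    rw [hK w hw]
  · obtain ⟨w, hw, rfl⟩ := exists_apply_eq_of_mem_eigenFil (hδ.trans_le hs) hv
    rwa [hK w (eigenFil_antitone D hs hw)]

/-- If `β X` is a derivation of the bilinear map `β`, then `β` adds up levels of the filtration. -/
theorem bracket_mem_eigenFil {β : E →L[ℝ] E →L[ℝ] E} {X : E}
    (hX : ∀ U V, β X (β U V) = β (β X U) V + β U (β X V)) {s t : ℝ} {U V : E}
    (hU : U ∈ eigenFil (β X) s) (hV : V ∈ eigenFil (β X) t) :
    β U V ∈ eigenFil (β X) (s + t) := by
  have h1 : ∀ μ, s ≤ μ → ∀ u, β X u = μ • u → ∀ v ∈ eigenFil (β X) t,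
      β u v ∈ eigenFil (β X) (s + t) := by
    intro μ hμ u hu v hv
    have h2 : eigenFil (β X) t ≤ (eigenFil (β X) (s + t)).comap (β u).toLinearMap := by
      refine eigenFil_le fun ν hν w hw => ?_
      refine mem_eigenFil (add_le_add hμ hν) ?_
      rw [ContinuousLinearMap.coe_coe, hX, hu, hw, map_smul, map_smul, add_smul]
      rfl
    exact h2 hv
  have h2 : eigenFil (β X) s ≤ (eigenFil (β X) (s + t)).comap (β.flip V).toLinearMap :=
    eigenFil_le fun μ hμ u hu => h1 μ hμ u hu V hV
  exact h2 hU

/-- The nonlinear part of `U ↦ X - exp (ad U) X`, where `ad` is a bilinear map `β`: the linear part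
is `-[U, X] = [X, U]`. -/
def orbitRest (β : E →L[ℝ] E →L[ℝ] E) (X U : E) : E :=
  X - NormedSpace.exp (β U) X - β X U

/-- If `U` and `U'` differ by an element of level `s`, then so do the iterated brackets
`(ad U)^k X` and `(ad U')^k X`, and from the second bracket on they differ by one of level
`s + δ`. -/
theorem pow_apply_sub_mem_eigenFil {β : E →L[ℝ] E →L[ℝ] E} {X : E}
    (hanti : ∀ U V, β U V = -β V U)
    (hX : ∀ U V, β X (β U V) = β (β X U) V + β U (β X V)) {δ s : ℝ} (hδ : 0 ≤ δ) {U U' : E}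
    (hU : U ∈ eigenFil (β X) δ) (hU' : U' ∈ eigenFil (β X) δ) (hUU' : U - U' ∈ eigenFil (β X) s)
    (k : ℕ) :
    (β U ^ (k + 1)) X ∈ eigenFil (β X) δ ∧
      (β U ^ (k + 1)) X - (β U' ^ (k + 1)) X ∈ eigenFil (β X) s ∧
      (β U ^ (k + 2)) X - (β U' ^ (k + 2)) X ∈ eigenFil (β X) (s + δ) := by
  have hmain : ∀ k, (β U ^ (k + 1)) X ∈ eigenFil (β X) δ →
      (β U ^ (k + 1)) X - (β U' ^ (k + 1)) X ∈ eigenFil (β X) s →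
      (β U ^ (k + 2)) X - (β U' ^ (k + 2)) X ∈ eigenFil (β X) (s + δ) := by
    intro k h1 h2
    have h3 : (β U ^ (k + 2)) X - (β U' ^ (k + 2)) X =
        β (U - U') ((β U ^ (k + 1)) X) + β U' ((β U ^ (k + 1)) X - (β U' ^ (k + 1)) X) := by
      rw [pow_succ' (β U) (k + 1), pow_succ' (β U') (k + 1)]
      simp only [mul_apply_eq_comp, map_sub, sub_apply]
      abel
    rw [h3]
    refine add_mem (bracket_mem_eigenFil hX hUU' h1) ?_
    rw [add_comm s δ]
    exact bracket_mem_eigenFil hX hU' h2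
  induction k with
  | zero =>
    have h1 : (β U ^ (0 + 1)) X ∈ eigenFil (β X) δ := by
      rw [zero_add, pow_one, hanti]
      exact neg_mem (apply_mem_eigenFil hU)
    have h2 : (β U ^ (0 + 1)) X - (β U' ^ (0 + 1)) X ∈ eigenFil (β X) s := by
      rw [zero_add, pow_one, pow_one, ← sub_apply, ← map_sub, hanti]
      exact neg_mem (apply_mem_eigenFil hUU')
    exact ⟨h1, h2, hmain 0 h1 h2⟩
  | succ k ih =>
    have h1 : (β U ^ (k + 1 + 1)) X ∈ eigenFil (β X) δ := by
      rw [pow_succ', mul_apply_eq_comp]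
      exact eigenFil_antitone _ (le_add_of_nonneg_left hδ) (bracket_mem_eigenFil hX hU ih.1)
    have h2 : (β U ^ (k + 1 + 1)) X - (β U' ^ (k + 1 + 1)) X ∈ eigenFil (β X) s :=
      eigenFil_antitone _ (le_add_of_nonneg_right hδ) ih.2.2
    exact ⟨h1, h2, hmain (k + 1) h1 h2⟩

/-- The nonlinear part raises the level of differences by `δ`. -/
theorem orbitRest_sub_mem {β : E →L[ℝ] E →L[ℝ] E} {X : E}
    (hanti : ∀ U V, β U V = -β V U)
    (hX : ∀ U V, β X (β U V) = β (β X U) V + β U (β X V)) {δ s : ℝ} (hδ : 0 ≤ δ) {U U' : E}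
    (hU : U ∈ eigenFil (β X) δ) (hU' : U' ∈ eigenFil (β X) δ)
    (hUU' : U - U' ∈ eigenFil (β X) s) :
    orbitRest β X U - orbitRest β X U' ∈ eigenFil (β X) (s + δ) := by
  have : CompleteSpace E := FiniteDimensional.complete ℝ E
  have hsum : ∀ W, HasSum (fun k : ℕ => ((k.factorial : ℝ)⁻¹) • (β W ^ k) X)
      (NormedSpace.exp (β W) X) := by
    intro W
    have h := (NormedSpace.exp_series_hasSum_exp' (𝕂 := ℝ) (β W)).mapL
      (ContinuousLinearMap.apply ℝ E X)
    exact h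
  -- The terms of degree 0 and 1 are removed from the difference of the two exponential series.
  have h1 := (hasSum_nat_add_iff' 2).mpr ((hsum U').sub (hsum U))
  have h2 : NormedSpace.exp (β U') X - NormedSpace.exp (β U) X -
      ∑ i ∈ Finset.range 2, (((i.factorial : ℝ)⁻¹) • (β U' ^ i) X -
        ((i.factorial : ℝ)⁻¹) • (β U ^ i) X) = orbitRest β X U - orbitRest β X U' := by
    simp only [Finset.sum_range_succ, Finset.sum_range_zero, Nat.factorial_zero, Nat.factorial_one,
      Nat.cast_one, inv_one, one_smul, pow_zero, pow_one, orbitRest, hanti U X, hanti U' X]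
    abel
  rw [h2] at h1
  rw [← h1.tsum_eq]
  refine tsum_mem (Submodule.closed_of_finiteDimensional _) fun k => ?_
  rw [← smul_sub, ← neg_sub, smul_neg]
  exact neg_mem (Submodule.smul_mem _ _
    (pow_apply_sub_mem_eigenFil hanti hX hδ hU hU' hUU' k).2.2)

/-- The iterates, starting at `0`, of `U ↦ K (V - orbitRest β X U)`. Where `K` inverts `β X`, a fixed
point of this map is a solution `U` of `X - exp (β U) X = V`. -/
def orbitIter (β : E →L[ℝ] E →L[ℝ] E) (X : E) (K : E →L[ℝ] E) : ℕ → E → E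
  | 0, _ => 0
  | k + 1, V => K (V - orbitRest β X (orbitIter β X K k V))

theorem contDiff_orbitRest (β : E →L[ℝ] E →L[ℝ] E) (X : E) : ContDiff ℝ ∞ (orbitRest β X) :=
  (contDiff_const.sub ((contDiff_exp_clm.comp β.contDiff).clm_apply contDiff_const)).sub
    (β X).contDiff

theorem contDiff_orbitIter (β : E →L[ℝ] E →L[ℝ] E) (X : E) (K : E →L[ℝ] E) (k : ℕ) :
    ContDiff ℝ ∞ (orbitIter β X K k) := by
  induction k with
  | zero => exact contDiff_const
  | succ k ih => exact K.contDiff.comp (contDiff_id.sub ((contDiff_orbitRest β X).comp ih))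

/-- The map `U ↦ X - exp (ad U) X` is a bijection of the sum of the eigenspaces of `ad X` for the
eigenvalues that are at least `δ > 0`, and its inverse is the restriction of a smooth map of the whole
space. The inverse is an iterate of `U ↦ K (V - orbitRest β X U)`: each step gains `δ` in the
filtration, so that the iteration is stationary once `(m + 1) δ` exceeds all eigenvalues. -/
theorem exists_smooth_inverse_orbit {β : E →L[ℝ] E →L[ℝ] E} {X : E}
    (hanti : ∀ U V, β U V = -β V U)
    (hX : ∀ U V, β X (β U V) = β (β X U) V + β U (β X V)) {δ : ℝ} (hδ : 0 < δ) :
    ∃ S : E → E, ContDiff ℝ ∞ S ∧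
      (∀ V ∈ eigenFil (β X) δ, S V ∈ eigenFil (β X) δ ∧ X - NormedSpace.exp (β (S V)) X = V) ∧
      (∀ U ∈ eigenFil (β X) δ, X - NormedSpace.exp (β U) X ∈ eigenFil (β X) δ ∧
        S (X - NormedSpace.exp (β U) X) = U) := by
  obtain ⟨K, hDK, hKD, hKF⟩ := exists_inverse_on_eigenFil (β X) hδ
  obtain ⟨M, hM⟩ := exists_eigenFil_eq_bot (β X)
  obtain ⟨m, hm⟩ : ∃ m : ℕ, M < (m + 1) * δ := by
    obtain ⟨m, hm⟩ := exists_nat_gt (M / δ)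
    refine ⟨m, ?_⟩
    rw [div_lt_iff₀ hδ] at hm
    linarith
  have hle : ∀ k : ℕ, δ ≤ (k + 1) * δ := fun k => by
    have : (0 : ℝ) ≤ k * δ := by positivity
    linarith
  have hstep : ∀ (k : ℕ) {U U' : E}, U ∈ eigenFil (β X) δ → U' ∈ eigenFil (β X) δ →
      U - U' ∈ eigenFil (β X) ((k + 1) * δ) →
      K (orbitRest β X U - orbitRest β X U') ∈ eigenFil (β X) (((k + 1 : ℕ) + 1) * δ) := by
    intro k U U' hU hU' h
    refine hKF _ (hle _) _ ?_
    have h1 := orbitRest_sub_mem hanti hX hδ.le hU hU' h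
    convert h1 using 2
    push_cast
    ring
  have hR0 : orbitRest β X 0 = 0 := by
    simp [orbitRest, NormedSpace.exp_zero]
  have hR : ∀ {U}, U ∈ eigenFil (β X) δ → orbitRest β X U ∈ eigenFil (β X) δ := by
    intro U hU
    have h := orbitRest_sub_mem hanti hX hδ.le hU (zero_mem _) (s := δ) (by rwa [sub_zero])
    rw [hR0, sub_zero] at h
    exact eigenFil_antitone _ (by linarith) h
  have hΨ : ∀ U, X - NormedSpace.exp (β U) X = β X U + orbitRest β X U := fun U => by
    rw [orbitRest]
    abel
  have hmem : ∀ {U}, U ∈ eigenFil (β X) δ →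
      X - NormedSpace.exp (β U) X ∈ eigenFil (β X) δ := fun {U} hU => by
    rw [hΨ]
    exact add_mem (apply_mem_eigenFil hU) (hR hU)
  have hinj : ∀ {U U' : E}, U ∈ eigenFil (β X) δ → U' ∈ eigenFil (β X) δ →
      X - NormedSpace.exp (β U) X = X - NormedSpace.exp (β U') X → U = U' := by
    intro U U' hU hU' h
    rw [hΨ, hΨ] at h
    have h1 : U - U' = -K (orbitRest β X U - orbitRest β X U') := by
      have h2 : K (β X U + orbitRest β X U) = K (β X U' + orbitRest β X U') := congrArg K h
      rw [map_add, map_add, hKD U hU, hKD U' hU'] at h2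
      rw [map_sub, neg_sub]
      exact sub_eq_sub_iff_add_eq_add.mpr (by rw [h2]; abel)
    have h2 : ∀ k : ℕ, U - U' ∈ eigenFil (β X) ((k + 1) * δ) := by
      intro k
      induction k with
      | zero =>
        rw [Nat.cast_zero, zero_add, one_mul]
        exact sub_mem hU hU'
      | succ k ih =>
        rw [h1]
        exact neg_mem (hstep k hU hU' ih)
    have h3 := h2 m
    rw [hM _ hm, Submodule.mem_bot, sub_eq_zero] at h3
    exact h3
  have hS : ∀ V ∈ eigenFil (β X) δ, orbitIter β X K m V ∈ eigenFil (β X) δ ∧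
      X - NormedSpace.exp (β (orbitIter β X K m V)) X = V := by
    intro V hV
    have h1 : ∀ k, orbitIter β X K k V ∈ eigenFil (β X) δ := by
      intro k
      induction k with
      | zero => exact zero_mem _
      | succ k ih => exact hKF δ le_rfl _ (sub_mem hV (hR ih))
    have h2 : ∀ k : ℕ, orbitIter β X K k V - orbitIter β X K (k + 1) V ∈
        eigenFil (β X) ((k + 1) * δ) := by
      intro k
      induction k with
      | zero =>
        rw [Nat.cast_zero, zero_add, one_mul]
        exact sub_mem (h1 0) (h1 1)
      | succ k ih =>
        have h3 : orbitIter β X K (k + 1) V - orbitIter β X K (k + 1 + 1) V =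
            -K (orbitRest β X (orbitIter β X K k V) - orbitRest β X (orbitIter β X K (k + 1) V)) := by
          rw [orbitIter, orbitIter, ← map_sub, ← map_neg]
          congr 1
          abel
        rw [h3]
        exact neg_mem (hstep k (h1 k) (h1 (k + 1)) ih)
    have h3 := h2 m
    rw [hM _ hm, Submodule.mem_bot, sub_eq_zero, orbitIter] at h3
    refine ⟨h1 m, ?_⟩
    rw [hΨ]
    nth_rewrite 1 [h3]
    rw [hDK _ (sub_mem hV (hR (h1 m)))]
    abel
  exact ⟨orbitIter β X K m, contDiff_orbitIter β X K m, hS, fun U hU =>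
    ⟨hmem hU, hinj (hS _ (hmem hU)).1 hU (hS _ (hmem hU)).2⟩⟩

end Filtration

/-! ### Manifolds with a single chart -/

section GlobalChart

open VectorField

variable {W : Type*} [NormedAddCommGroup W] [NormedSpace ℝ W] {M : Type*} [TopologicalSpace M]

/-- The manifold structure on `M` whose only chart is a homeomorphism onto a vector space. -/
@[reducible]
def globalChart (F : M ≃ₜ W) : ChartedSpace W M :=
  F.toOpenPartialHomeomorph.singletonChartedSpace rfl

theorem isManifold_globalChart (F : M ≃ₜ W) :
    @IsManifold ℝ _ W _ _ W _ 𝓘(ℝ, W) ∞ M _ (globalChart F) :=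
  F.toOpenPartialHomeomorph.isManifold_singleton rfl

theorem extChartAt_globalChart (F : M ≃ₜ W) (n : M) :
    letI := globalChart F
    extChartAt 𝓘(ℝ, W) n = F.toPartialEquiv := by
  let _ := globalChart F
  change F.toOpenPartialHomeomorph.toPartialEquiv.trans (PartialEquiv.refl W) = _
  rw [PartialEquiv.trans_refl]
  rfl

theorem contMDiff_globalChart (F : M ≃ₜ W) :
    letI := globalChart F
    ContMDiff 𝓘(ℝ, W) 𝓘(ℝ, W) ∞ F := by
  let _ := globalChart F
  have := isManifold_globalChart F
  intro n
  have h := contMDiffAt_extChartAt (I := 𝓘(ℝ, W)) (n := ∞) (x := n)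
  rwa [extChartAt_globalChart F n] at h

theorem contMDiff_globalChart_symm (F : M ≃ₜ W) :
    letI := globalChart F
    ContMDiff 𝓘(ℝ, W) 𝓘(ℝ, W) ∞ F.symm := by
  let _ := globalChart F
  have := isManifold_globalChart F
  have h := contMDiffOn_extChartAt_symm (I := 𝓘(ℝ, W)) (n := ∞) (F.symm 0)
  rw [extChartAt_globalChart F] at h
  exact contMDiffOn_univ.mp h

theorem hasMFDerivAt_globalChart (F : M ≃ₜ W) (n : M) :
    letI := globalChart F
    HasMFDerivAt 𝓘(ℝ, W) 𝓘(ℝ, W) F n (ContinuousLinearMap.id ℝ W) := by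
  let _ := globalChart F
  have := isManifold_globalChart F
  have h1 := (mdifferentiableAt_extChartAt (I := 𝓘(ℝ, W)) (mem_chart_source W n)).hasMFDerivAt
  rw [mfderiv_extChartAt_self, extChartAt_globalChart F] at h1
  exact h1

/-- The vector field on `M` whose value in the preferred chart at each point is `V`. -/
def constField [ChartedSpace W M] (V : W) (n : M) : TangentSpace 𝓘(ℝ, W) n := V

theorem mpullback_globalChart_constField (F : M ≃ₜ W) (V : W) :
    letI := globalChart F
    mpullback 𝓘(ℝ, W) 𝓘(ℝ, W) F (constField V) = constField V := by
  let _ := globalChart F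
  ext1 n
  rw [mpullback_apply, (hasMFDerivAt_globalChart F n).mfderiv]
  exact congrArg (fun T : W →L[ℝ] W => T V) ContinuousLinearMap.inverse_id

theorem contMDiff_constField_vectorSpace (V : W) : ContMDiff 𝓘(ℝ, W) 𝓘(ℝ, W).tangent ∞
    (fun w : W => (⟨w, constField V w⟩ : TangentBundle 𝓘(ℝ, W) W)) :=
  contMDiff_vectorSpace_iff_contDiff.mpr contDiff_const

theorem contMDiff_constField_globalChart [CompleteSpace W] (F : M ≃ₜ W) (V : W) :
    letI := globalChart F
    haveI := isManifold_globalChart F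
    ContMDiff 𝓘(ℝ, W) 𝓘(ℝ, W).tangent ∞
      (fun n : M => (⟨n, constField V n⟩ : TangentBundle 𝓘(ℝ, W) M)) := by
  let _ := globalChart F
  have := isManifold_globalChart F
  have h := (contMDiff_constField_vectorSpace V).mpullback_vectorField (contMDiff_globalChart F)
    (fun n => by
      rw [(hasMFDerivAt_globalChart F n).mfderiv]
      exact ⟨ContinuousLinearEquiv.refl ℝ W, rfl⟩) (by simp)
  rwa [mpullback_globalChart_constField] at h

theorem mlieBracket_constField_globalChart [CompleteSpace W] (F : M ≃ₜ W) (V V' : W) (n : M) :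
    letI := globalChart F
    mlieBracket 𝓘(ℝ, W) (constField V) (constField V') n = 0 := by
  let _ := globalChart F
  have := isManifold_globalChart F
  have : IsManifold 𝓘(ℝ, W) (minSmoothness ℝ 2) M := by
    rw [minSmoothness_of_isRCLikeNormedField]
    exact IsManifold.of_le (n := ∞) ENat.LEInfty.out
  have h := mpullback_mlieBracket (n := ∞) (x₀ := n)
    ((contMDiff_constField_vectorSpace V).mdifferentiable (by simp) (F n))
    ((contMDiff_constField_vectorSpace V').mdifferentiable (by simp) (F n))
    (contMDiff_globalChart F n) (by
      rw [minSmoothness_of_isRCLikeNormedField]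
      exact ENat.LEInfty.out)
  rw [mpullback_globalChart_constField, mpullback_globalChart_constField] at h
  have h0 : mlieBracket 𝓘(ℝ, W) (constField V) (constField V') (F n) = 0 := by
    rw [← mlieBracketWithin_univ, mlieBracketWithin_eq_lieBracketWithin]
    change fderivWithin ℝ (fun _ : W => V') Set.univ (F n) V -
      fderivWithin ℝ (fun _ : W => V) Set.univ (F n) V' = 0
    simp
  rw [← h, mpullback_apply, h0]
  exact map_zero _

/-- The flow of a constant field is a translation in the chart. -/
theorem isMIntegralCurve_globalChart (F : M ≃ₜ W) (V : W) (n : M) :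
    letI := globalChart F
    IsMIntegralCurve (I := 𝓘(ℝ, W)) (fun t : ℝ => F.symm (F n + t • V)) (constField V) := by
  let _ := globalChart F
  have := isManifold_globalChart F
  intro t
  have h1 : HasMFDerivAt 𝓘(ℝ, W) 𝓘(ℝ, W) F.symm (F n + t • V) (ContinuousLinearMap.id ℝ W) := by
    have h2 := ((contMDiff_globalChart_symm F).mdifferentiable (by simp)
      (F n + t • V)).hasMFDerivAt
    have h3 := HasMFDerivAt.comp (F n + t • V)
      (hasMFDerivAt_globalChart F (F.symm (F n + t • V))) h2
    have h4 : F ∘ F.symm = id := by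
      ext w
      simp
    rw [h4] at h3
    have h5 := hasMFDerivAt_unique h3 (hasMFDerivAt_id _)
    exact h2.congr_mfderiv h5
  have h6 : HasDerivAt (fun t : ℝ => F n + t • V) V t := by
    simpa using ((hasDerivAt_id t).smul_const V).const_add (F n)
  exact HasMFDerivAt.comp t h1 h6.hasFDerivAt.hasMFDerivAt

end GlobalChart

/-! ### The chart `n ↦ X - Ad n X` of `N(l)` and the vertical vectors -/

section OrbitChart

variable {E : Type*} [NormedAddCommGroup E] [NormedSpace ℝ E] [FiniteDimensional ℝ E]
  {G : Type*} [TopologicalSpace G] [ChartedSpace E G] [Group G] [LieGroup 𝓘(ℝ, E) ∞ G]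

open Filter Topology VectorField Set

theorem adL_skew (U V : E) : adL E G U V = -adL E G V U :=
  (adL_apply (G := G) U V).trans ((lie_skew (L := GroupLieAlgebra 𝓘(ℝ, E) G) U V).symm.trans
    (congrArg Neg.neg (adL_apply (G := G) V U).symm))

theorem adL_leibniz (X U V : E) :
    adL E G X (adL E G U V) = adL E G (adL E G X U) V + adL E G U (adL E G X V) := by
  have h : ∀ X U V : GroupLieAlgebra 𝓘(ℝ, E) G,
      adL E G X (adL E G U V) = adL E G (adL E G X U) V + adL E G U (adL E G X V) := by
    intro X U V
    rw [adL_apply U V, adL_apply X U, adL_apply X V]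
    exact (adL_apply X ⁅U, V⁆).trans ((leibniz_lie X U V).trans
      (congrArg₂ (· + ·) (adL_apply ⁅X, U⁆ V).symm (adL_apply U ⁅X, V⁆).symm))
  exact h X U V

theorem Ad_Ad_inv (g : G) (Z : E) : Ad g (Ad g⁻¹ Z) = Z :=
  congrArg (fun T : E →L[ℝ] E => T Z) (Ad_comp_inv g)

theorem Ad_inv_Ad (g : G) (Z : E) : Ad g⁻¹ (Ad g Z) = Z :=
  congrArg (fun T : E →L[ℝ] E => T Z) (Ad_inv_comp g)

/-- `Ad g` as an automorphism of the Lie algebra. -/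
def AdLie (g : G) : GroupLieAlgebra 𝓘(ℝ, E) G ≃ₗ⁅ℝ⁆ GroupLieAlgebra 𝓘(ℝ, E) G where
  toFun Z := Ad (E := E) g Z
  map_add' Z Z' := (Ad (E := E) g).map_add Z Z'
  map_smul' c Z := (Ad (E := E) g).map_smul c Z
  map_lie' {Z Z'} := by
    have h := Ad_adL (E := E) g Z Z'
    rw [adL_apply] at h
    exact h.trans (adL_apply _ _)
  invFun Z := Ad (E := E) g⁻¹ Z
  left_inv Z := Ad_inv_Ad (E := E) g Z
  right_inv Z := Ad_Ad_inv (E := E) g Z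

variable [LieAlgebra.IsSemisimple ℝ (GroupLieAlgebra 𝓘(ℝ, E) G)]

/-- The centre of a semisimple Lie algebra is trivial. -/
theorem adL_injective : Function.Injective (adL E G) := by
  have h : ∀ U : GroupLieAlgebra 𝓘(ℝ, E) G, adL E G U = 0 → U = 0 := by
    intro U hU
    have h1 : U ∈ LieAlgebra.center ℝ (GroupLieAlgebra 𝓘(ℝ, E) G) := by
      rw [LieAlgebra.center, LieModule.mem_maxTrivSubmodule]
      intro Z
      rw [← lie_skew, ← adL_apply, hU]
      exact neg_zero
    rwa [LieAlgebra.center_eq_bot, LieSubmodule.mem_bot] at h1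
  exact (injective_iff_map_eq_zero _).mpr h

theorem killingForm_dualVector (l : Module.Dual ℝ (GroupLieAlgebra 𝓘(ℝ, E) G))
    (Y : GroupLieAlgebra 𝓘(ℝ, E) G) : killingForm ℝ _ (dualVector l) Y = l Y :=
  LinearMap.BilinForm.apply_toDual_symm_apply l Y

theorem killingForm_AdLie (g : G) (Y Z : GroupLieAlgebra 𝓘(ℝ, E) G) :
    killingForm ℝ _ (AdLie g Y) (AdLie g Z) = killingForm ℝ _ Y Z := by
  exact LieAlgebra.killingForm_of_equiv_apply (AdLie g) Y Z

theorem eq_of_killingForm_eq {Y Y' : GroupLieAlgebra 𝓘(ℝ, E) G}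
    (h : ∀ Z, killingForm ℝ (GroupLieAlgebra 𝓘(ℝ, E) G) Y Z = killingForm ℝ _ Y' Z) : Y = Y' := by
  have h1 := (LieAlgebra.IsKilling.killingForm_nondegenerate ℝ (GroupLieAlgebra 𝓘(ℝ, E) G)).1
    (Y - Y') fun Z => by rw [map_sub, LinearMap.sub_apply, h, sub_self]
  exact sub_eq_zero.mp h1

/-- The form `(Y, W) ↦ l [Y, W]` in terms of the Killing form. -/
theorem apply_lie_eq_killingForm (l : Module.Dual ℝ (GroupLieAlgebra 𝓘(ℝ, E) G))
    (Y W : GroupLieAlgebra 𝓘(ℝ, E) G) :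
    l ⁅Y, W⁆ = -killingForm ℝ _ ⁅dualVector l, W⁆ Y := by
  rw [← killingForm_dualVector, killingForm, ← lie_skew (dualVector l) W, map_neg,
    LinearMap.neg_apply, neg_neg, LieModule.traceForm_apply_lie_apply _ _ _ W,
    ← LieModule.traceForm_apply_lie_apply, LieModule.traceForm_comm]

/-- A vector of `T_n G` represents the vertical vector for `V` exactly when the derivative of
`g ↦ X_l - Ad g X_l` maps it to `V`. -/
theorem isVerticalVector_iff (l : Module.Dual ℝ (GroupLieAlgebra 𝓘(ℝ, E) G)) (V : nilSpace l)
    (n : G) (W : TangentSpace 𝓘(ℝ, E) n) :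
    IsVerticalVector l V n (Submodule.Quotient.mk W) ↔
      AdLie n ⁅dualVector l, leftTriv n W⁆ = toLieAlg V := by
  have h1 : ∀ Y : TangentSpace 𝓘(ℝ, E) n,
      kirillovForm l n (Submodule.Quotient.mk Y) (Submodule.Quotient.mk W) =
        -killingForm ℝ _ (AdLie n ⁅dualVector l, leftTriv n W⁆) (AdLie n (leftTriv n Y)) := by
    intro Y
    rw [killingForm_AdLie, ← apply_lie_eq_killingForm]
    rfl
  have h2 : ∀ Y : TangentSpace 𝓘(ℝ, E) n,
      eta l V (projDeriv l n Y) = -killingForm ℝ _ (toLieAlg V) (AdLie n (leftTriv n Y)) := by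
    intro Y
    have h3 : AdLie n (leftTriv n Y) = rightTriv n Y := (rightTriv_eq n Y).symm
    rw [h3]
    rfl
  constructor
  · intro h
    refine eq_of_killingForm_eq fun Z => ?_
    -- Test with the vector of `T_n G` that the right translation by `n⁻¹` maps to `Z`.
    have h4 := h (mulInvariantVectorField ((AdLie n).symm Z) n)
    rw [h1, h2, leftTriv_mulInvariantVectorField, LieEquiv.apply_symm_apply, neg_inj] at h4
    exact h4
  · intro h Y
    rw [h1, h2, h]

variable (G) in
/-- The map `g ↦ X - Ad g X`. -/
def orbitMap (X : E) (g : G) : E := X - Ad g X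

theorem contMDiff_orbitMap (X : E) : ContMDiff 𝓘(ℝ, E) 𝓘(ℝ, E) ∞ (orbitMap G X) :=
  contMDiff_const.sub (contMDiff_Ad.clm_apply contMDiff_const)

theorem mfderiv_orbitMap (X : GroupLieAlgebra 𝓘(ℝ, E) G) (g : G) (W : TangentSpace 𝓘(ℝ, E) g) :
    mfderiv 𝓘(ℝ, E) 𝓘(ℝ, E) (orbitMap (E := E) G X) g W = AdLie g ⁅X, leftTriv g W⁆ := by
  let x : E := X
  have h1 : HasFDerivAt (fun T : E →L[ℝ] E => x - T x) (-(ContinuousLinearMap.apply ℝ E x))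
      (Ad g : E →L[ℝ] E) := (ContinuousLinearMap.apply ℝ E x).hasFDerivAt.const_sub x
  have h2 : HasMFDerivAt 𝓘(ℝ, E) 𝓘(ℝ, E) (orbitMap (E := E) G X) g
      ((-(ContinuousLinearMap.apply ℝ E x)).comp (adDeriv E g) : E →L[ℝ] E) :=
    HasMFDerivAt.comp (f := Ad) (g := fun T : E →L[ℝ] E => x - T x) g h1.hasMFDerivAt
      (hasMFDerivAt_Ad (E := E) g)
  rw [h2.mfderiv]
  have h3 : ∀ y : E, -Ad (E := E) g (adL E G y x) = Ad g (adL E G x y) := fun y => by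
    rw [adL_skew x y, map_neg]
  exact (h3 (leftTriv g W)).trans (congrArg (Ad (E := E) g) (adL_apply X (leftTriv g W)))

theorem nilSpace_eq (l : Module.Dual ℝ (GroupLieAlgebra 𝓘(ℝ, E) G)) :
    nilSpace l = ⨆ μ : {μ : ℝ // 0 < μ},
      Module.End.eigenspace (adL E G (dualVector l)).toLinearMap μ.1 := by
  have h1 : ∀ X : GroupLieAlgebra 𝓘(ℝ, E) G,
      LieAlgebra.ad ℝ (GroupLieAlgebra 𝓘(ℝ, E) G) X = (adL E G X).toLinearMap :=
    fun X => LinearMap.ext fun Z => (adL_apply X Z).symm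
  have h2 : nilSpace l = nilAlg l := Submodule.map_id _
  rw [h2, nilAlg, h1]
  rfl

theorem mem_nilGroup_iff [T2Space G] {l : Module.Dual ℝ (GroupLieAlgebra 𝓘(ℝ, E) G)} {g : G} :
    g ∈ nilGroup l ↔ ∃ U ∈ nilSpace l, expMap U = g := by
  have h2 : nilSpace l = nilAlg l := Submodule.map_id _
  rw [h2]
  exact exists_congr fun U => and_congr_right fun _ => isExp_iff

theorem Ad_expMap [T2Space G] (U : E) : Ad (expMap U : G) = NormedSpace.exp (adL E G U) := by
  have h := Ad_oneParam (E := E) (G := G) U 1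
  rwa [one_smul] at h

/-- The map `n ↦ X_l - Ad n X_l` is a homeomorphism from `N(l)`, with the topology induced by `G`,
onto `𝔫(l)`, and its inverse is smooth as a map to `G`. -/
theorem exists_homeomorph_nilSpace [T2Space G]
    (l : Module.Dual ℝ (GroupLieAlgebra 𝓘(ℝ, E) G)) :
    ∃ F : nilGroup l ≃ₜ nilSpace l, (∀ n, (F n : E) = orbitMap (E := E) G (dualVector l) n) ∧
      ContMDiff 𝓘(ℝ, nilSpace l) 𝓘(ℝ, E) ∞ (fun V => (F.symm V : G)) := by
  let X : E := dualVector l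
  obtain ⟨δ, hδ, hnil⟩ := exists_iSup_eigenspace_pos_eq (adL E G X)
  have hN : nilSpace l = eigenFil (adL E G X) δ := (nilSpace_eq l).trans hnil
  obtain ⟨S, hS, hS1, hS2⟩ := exists_smooth_inverse_orbit (β := adL E G) (X := X) adL_skew
    (adL_leibniz X) hδ
  rw [← hN] at hS1 hS2
  have hexp : ∀ U : E, orbitMap G X (expMap U) = X - NormedSpace.exp (adL E G U) X := fun U => by
    rw [orbitMap, Ad_expMap]
  have hmem : ∀ n : nilGroup l, orbitMap G X (n : G) ∈ nilSpace l ∧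
      expMap (S (orbitMap G X (n : G))) = (n : G) := by
    rintro ⟨n, hn⟩
    obtain ⟨U, hU, rfl⟩ := mem_nilGroup_iff.mp hn
    rw [hexp, (hS2 U hU).2]
    exact ⟨(hS2 U hU).1, rfl⟩
  have hsm : ContMDiff 𝓘(ℝ, nilSpace l) 𝓘(ℝ, E) ∞
      (fun V : nilSpace l => (expMap (S (V : E)) : G)) :=
    (contMDiff_expMap adL_injective).comp (hS.comp (nilSpace l).subtypeL.contDiff).contMDiff
  let F : nilGroup l ≃ₜ nilSpace l :=
    { toFun := fun n => ⟨orbitMap G X (n : G), (hmem n).1⟩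
      invFun := fun V => ⟨expMap (S (V : E)), mem_nilGroup_iff.mpr ⟨_, (hS1 V V.2).1, rfl⟩⟩
      left_inv := fun n => Subtype.ext (hmem n).2
      right_inv := fun V => Subtype.ext ((hexp _).trans (hS1 V V.2).2)
      continuous_toFun := ((contMDiff_orbitMap X).continuous.comp continuous_subtype_val).subtype_mk _
      continuous_invFun := hsm.continuous.subtype_mk _ }
  exact ⟨F, fun _ => rfl, hsm⟩

end OrbitChart

end HyperbolicOrbit

end

open HyperbolicOrbit in
theorem proposition6p6
    {E : Type*} [NormedAddCommGroup E] [NormedSpace ℝ E] [FiniteDimensional ℝ E]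
    {G : Type*} [TopologicalSpace G] [T2Space G] [ConnectedSpace G] [ChartedSpace E G] [Group G]
    [LieGroup 𝓘(ℝ, E) ∞ G] [LieAlgebra.IsSemisimple ℝ (GroupLieAlgebra 𝓘(ℝ, E) G)]
    [Finite (Subgroup.center G)]
    (l : Module.Dual ℝ (GroupLieAlgebra 𝓘(ℝ, E) G)) (hl : IsRealHyperbolic l) :
    ∃ (_ : ChartedSpace (nilSpace l) (nilGroup l))
      (_ : IsManifold 𝓘(ℝ, nilSpace l) ∞ (nilGroup l)), IsEmbeddedSubmanifold l ∧
      ∃ H : nilSpace l → (n : nilGroup l) → TangentSpace 𝓘(ℝ, nilSpace l) n,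
        (∀ (V : nilSpace l) (n : nilGroup l) (w : TangentSpace 𝓘(ℝ, nilSpace l) n),
          IsVerticalVector l V n (fiberDeriv l n w) ↔ w = H V n) ∧
        (∀ V : nilSpace l, ContMDiff 𝓘(ℝ, nilSpace l) 𝓘(ℝ, nilSpace l).tangent ∞
          (fun n => (⟨n, H V n⟩ : TangentBundle 𝓘(ℝ, nilSpace l) (nilGroup l)))) ∧
        (∀ V₁ V₂ : nilSpace l, ∀ n : nilGroup l,
          VectorField.mlieBracket 𝓘(ℝ, nilSpace l) (H V₁) (H V₂) n = 0) ∧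
        ∃ Φ : nilSpace l → ℝ × nilGroup l → nilGroup l,
          (∀ V : nilSpace l,
            ContMDiff (𝓘(ℝ, ℝ).prod 𝓘(ℝ, nilSpace l)) 𝓘(ℝ, nilSpace l) ∞ (Φ V) ∧
            ∀ n : nilGroup l, Φ V (0, n) = n ∧
              IsMIntegralCurve (I := 𝓘(ℝ, nilSpace l)) (fun t : ℝ => Φ V (t, n)) (H V)) ∧
          ∃ D : Diffeomorph 𝓘(ℝ, nilSpace l) 𝓘(ℝ, nilSpace l) (nilSpace l) (nilGroup l) ∞,
            ∀ V : nilSpace l, D V = Φ V (1, nilGroupOne l) := by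
  obtain ⟨F, hF, hFsymm⟩ := exists_homeomorph_nilSpace l
  let _ := globalChart F
  have _ := isManifold_globalChart F
  have hFm := contMDiff_globalChart F
  have hFsm := contMDiff_globalChart_symm F
  have hval : ContMDiff 𝓘(ℝ, nilSpace l) 𝓘(ℝ, E) ∞ (Subtype.val : nilGroup l → G) := by
    have h := hFsymm.comp hFm
    have h1 : (fun V => (F.symm V : G)) ∘ F = Subtype.val := by
      ext n
      simp
    rwa [h1] at h
  -- The derivative of `g ↦ X - Ad g X` is a left inverse of that of the inclusion of `N(l)`.
  have hderiv : ∀ (n : nilGroup l) (w : TangentSpace 𝓘(ℝ, nilSpace l) n),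
      mfderiv 𝓘(ℝ, E) 𝓘(ℝ, E) (orbitMap (E := E) G (dualVector l)) (n : G)
        (mfderiv 𝓘(ℝ, nilSpace l) 𝓘(ℝ, E) (Subtype.val : nilGroup l → G) n w) =
      (nilSpace l).subtype w := by
    intro n w
    have h1 := HasMFDerivAt.comp n
      ((contMDiff_orbitMap (E := E) (G := G) (dualVector l)).mdifferentiable (by simp)
        (n : G)).hasMFDerivAt
      ((hval.mdifferentiable (by simp) n).hasMFDerivAt)
    have h2 := HasMFDerivAt.comp n
      (nilSpace l).subtypeL.hasFDerivAt.hasMFDerivAt (hasMFDerivAt_globalChart F n)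
    have h3 : orbitMap (E := E) G (dualVector l) ∘ (Subtype.val : nilGroup l → G) =
        (nilSpace l).subtypeL ∘ F := by
      ext1 n
      exact (hF n).symm
    rw [h3] at h1
    exact congrArg (fun T : nilSpace l →L[ℝ] E => T w) (hasMFDerivAt_unique h1 h2)
  have hF1 : F (nilGroupOne l) = 0 := by
    refine Subtype.ext ((hF _).trans ?_)
    have h : ∀ X : E, orbitMap G X 1 = 0 := fun X => by
      rw [orbitMap, Ad_one]
      exact sub_self X
    exact h _
  refine ⟨globalChart F, isManifold_globalChart F, ⟨hval, fun n w w' h => ?_⟩,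
    fun V => constField V, fun V n w => ?_, contMDiff_constField_globalChart F,
    mlieBracket_constField_globalChart F, fun V p => F.symm (F p.2 + p.1 • V), fun V => ⟨?_, ?_⟩,
    { toEquiv := F.symm.toEquiv
      contMDiff_toFun := hFsm
      contMDiff_invFun := hFm }, fun V => ?_⟩
  · have h1 := (hderiv n w).symm.trans ((congrArg _ h).trans (hderiv n w'))
    exact Subtype.ext h1
  · have h1 := isVerticalVector_iff l V n
      (mfderiv 𝓘(ℝ, nilSpace l) 𝓘(ℝ, E) (Subtype.val : nilGroup l → G) n w)
    refine h1.trans ?_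
    rw [← mfderiv_orbitMap, hderiv]
    exact Subtype.ext_iff.symm
  · refine hFsm.comp ?_
    have h1 : ContMDiff (𝓘(ℝ, ℝ).prod 𝓘(ℝ, nilSpace l)) 𝓘(ℝ, nilSpace l) ∞
        (fun p : ℝ × nilGroup l => F p.2) := hFm.comp contMDiff_snd
    exact h1.add (contMDiff_fst.smul contMDiff_const)
  · intro n
    refine ⟨?_, isMIntegralCurve_globalChart F V n⟩
    simp
  · change F.symm V = F.symm (F (nilGroupOne l) + (1 : ℝ) • V)
    rw [hF1, zero_add, one_smul]
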